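/- Let $X$ be a countable (finite or infinite) structure in a countable first-order language that is $\omega$-categorical, i.e. every countable model of the first-order theory of $X$ is isomorphic to $X$. Let $G = \mathrm{Aut}(X)$, with the topology of pointwise convergence ($X$ being discrete). Suppose that $X$ admits weak elimination of imaginaries: whenever $\alpha \subseteq X^m$ is an equivalence class of an equivalence relation, definable without parameters, on a subset of $X^m$ that is definable without parameters, there are $n \geq 0$ and a first-order formula $\phi(\bar x, \bar y)$ without parameters such that the set of tuples $\bar c \in X^n$ with $\alpha = \{\bar x \in X^m : \phi(\bar x, \bar c)\}$ is finite and non-empty. Let $X_0$ be the set of points of $X$ that are not fixed by $G$, and let $\ell^1_+(X_0)$ be the set of non-negative functions in $\ell^1(X_0)$ of norm $1$, on which $G$ acts by $(g \cdot f)(x) = f(g^{-1} \cdot x)$. A compact set $Q \subseteq G$ is called a Kazhdan set for $G$ if there is $\varepsilon > 0$ such that every strongly continuous unitary representation $\pi$ of $G$ on a complex Hilbert space that has a non-zero vector $\xi$ with $\|\pi(g)\xi - \xi\| \leq \varepsilon \|\xi\|$ for all $g \in Q$ has a non-zero $G$-invariant vector. For $Q \subseteq G$, consider the condition $$\inf_{f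 \in \ell^1_+(X_0)} \ \sup_{g \in Q} \ \|g \cdot f - f\|_1 > 0, \qquad (*)$$ where the infimum is $+\infty$ if $X_0$ is empty and the supremum is $0$ if $Q$ is empty. If $Q \subseteq G$ is compact and $(*)$ holds, then $Q$ is a Kazhdan set for $G$. Conversely, if all orbits of the action of $G$ on $X_0$ are infinite and $Q$ is a Kazhdan set for $G$, then $(*)$ holds. -/

import Mathlib

universe u v w x

open scoped FirstOrder

namespace KazhdanOligomorphic

section Structures

variable (L : FirstOrder.Language.{u, v}) (X : Type w) [L.Structure X]

/-- A structure is `ω`-categorical if it is countable and all countable models of its complete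
first-order theory are isomorphic. Finite structures qualify: every model of the theory of a
finite structure is isomorphic to it, and none has cardinality `ℵ₀`. -/
def IsOmegaCategorical : Prop :=
  Countable X ∧ Cardinal.Categorical Cardinal.aleph0.{w} (L.completeTheory X)

/-- `α ⊆ X ^ m` is an imaginary element of `X`: an equivalence class of a (parameter-free)
definable equivalence relation `E` on a (parameter-free) definable set `D ⊆ X ^ m`. -/
def IsImaginary (m : ℕ) (α : Set (Fin m → X)) : Prop :=
  ∃ (D : Set (Fin m → X)) (E : (Fin m → X) → (Fin m → X) → Prop),
    (∅ : Set X).Definable L D ∧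
    (∅ : Set X).Definable L {v : Fin m ⊕ Fin m → X | E (v ∘ Sum.inl) (v ∘ Sum.inr)} ∧
    (∀ a b, E a b → a ∈ D ∧ b ∈ D) ∧
    (∀ a ∈ D, E a a) ∧
    (∀ a b, E a b → E b a) ∧
    (∀ a b c, E a b → E b c → E a c) ∧
    ∃ a ∈ D, α = {b | E a b}

/-- The set of tuples `c` such that `φ(·, c)` defines `α`. -/
def representatives {m n : ℕ} (φ : L.Formula (Fin m ⊕ Fin n)) (α : Set (Fin m → X)) :
    Set (Fin n → X) :=
  {c | α = {a : Fin m → X | φ.Realize (Sum.elim a c)}}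

/-- Weak elimination of imaginaries: for every imaginary `α` there is a formula `φ(x, y)`
(without parameters) such that the set of tuples `c` for which `φ(·, c)` defines `α` is finite and
non-empty. The length `n` of the tuples may be `0`. -/
def WeakEliminationOfImaginaries : Prop :=
  ∀ (m : ℕ) (α : Set (Fin m → X)), IsImaginary L X m α →
    ∃ (n : ℕ) (φ : L.Formula (Fin m ⊕ Fin n)),
      (representatives L X φ α).Finite ∧ (representatives L X φ α).Nonempty

/-- The automorphism group of the structure `X`. -/
abbrev Aut : Type w := X ≃[L] X

instance : Group (Aut L X) where
  mul g h := g.comp h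
  one := FirstOrder.Language.Equiv.refl L X
  inv g := g.symm
  mul_assoc _ _ _ := rfl
  one_mul _ := rfl
  mul_one _ := rfl
  inv_mul_cancel g := by
    apply FirstOrder.Language.Equiv.ext
    intro a
    exact g.symm_apply_apply a

instance : MulAction (Aut L X) X where
  smul g a := g a
  one_smul _ := rfl
  mul_smul _ _ _ := rfl

/-- The topology of pointwise convergence on `Aut X`, where `X` is discrete. -/
instance : TopologicalSpace (Aut L X) :=
  TopologicalSpace.induced (fun (g : Aut L X) (a : X) => g a)
    (@Pi.topologicalSpace X (fun _ => X) (fun _ => ⊥))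

/-- `X₀`: the set of the points of `X` that are not fixed by `Aut X`, with the action of `Aut X`. -/
def nonfixed : SubMulAction (Aut L X) X where
  carrier := {a | ¬ ∀ g : Aut L X, g • a = a}
  smul_mem' h a ha := by
    intro hfix
    apply ha
    have h1 : a = h • a := by
      have := hfix h⁻¹
      rwa [inv_smul_smul] at this
    intro g
    have h2 := hfix g
    rwa [← h1] at h2

end Structures

section Representations

/-- A unitary representation of the topological group `G` on `H`: a strongly continuous
homomorphism to the unitary group of `H`. -/
structure UnitaryRep (G : Type w) [Group G] [TopologicalSpace G] (H : Type x)
    [NormedAddCommGroup H] [InnerProductSpace ℂ H] where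
  /-- the homomorphism -/
  hom : G →* (H ≃ₗᵢ[ℂ] H)
  /-- strong continuity -/
  strongly_continuous : ∀ ξ : H, Continuous fun g : G => hom g ξ

variable {G : Type w} [Group G] [TopologicalSpace G]

/-- A non-zero vector moved by at most `ε ‖ξ‖` by all elements of `Q`. -/
def UnitaryRep.IsAlmostInvariant {H : Type x} [NormedAddCommGroup H] [InnerProductSpace ℂ H]
    (π : UnitaryRep G H) (Q : Set G) (ε : ℝ) (ξ : H) : Prop :=
  ξ ≠ 0 ∧ ∀ g ∈ Q, ‖π.hom g ξ - ξ‖ ≤ ε * ‖ξ‖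

/-- Every unitary representation of `G` on a complex Hilbert space with a `(Q, ε)`-invariant
vector has a non-zero invariant vector. -/
def IsKazhdanPair (Q : Set G) (ε : ℝ) : Prop :=
  ∀ (H : Type x) [NormedAddCommGroup H] [InnerProductSpace ℂ H] [CompleteSpace H]
    (π : UnitaryRep G H),
    (∃ ξ : H, π.IsAlmostInvariant Q ε ξ) → ∃ ξ : H, ξ ≠ 0 ∧ ∀ g : G, π.hom g ξ = ξ

/-- A Kazhdan set for `G`: a compact set `Q` that forms a Kazhdan pair with some `ε > 0`. -/
def IsKazhdanSet (Q : Set G) : Prop :=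
  IsCompact Q ∧ ∃ ε : ℝ, 0 < ε ∧ IsKazhdanPair.{w, x} Q ε

end Representations

section EllOne

/-- `ℓ¹₊(Y)`: the non-negative functions on `Y` of `ℓ¹`-norm `1`. -/
def ellOnePlus (Y : Type w) : Set (Y → ℝ) :=
  {f | (∀ y, 0 ≤ f y) ∧ HasSum f 1}

/-- `‖g · f - f‖₁`, where `(g · f) y = f (g⁻¹ y)`, as an extended non-negative real number. -/
noncomputable def ellOneDisplacement {G : Type x} {Y : Type w} [Group G] [MulAction G Y]
    (g : G) (f : Y → ℝ) : ENNReal :=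
  ∑' y : Y, ‖f (g⁻¹ • y) - f y‖ₑ

/-- `inf_{f ∈ ℓ¹₊(Y)} sup_{g ∈ Q} ‖g · f - f‖₁`, computed in `[0, ∞]` (it is `∞` if `Y` is
empty). -/
noncomputable def ellOneConstant {G : Type x} (Y : Type w) [Group G] [MulAction G Y]
    (Q : Set G) : ENNReal :=
  ⨅ f ∈ ellOnePlus Y, ⨆ g ∈ Q, ellOneDisplacement g f

end EllOne

end KazhdanOligomorphic

open KazhdanOligomorphic

/-! By a Ryll-Nardzewski argument, `Aut X` has finitely many orbits on tuples of each length and its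
invariant relations are definable (`exists_finite_orbit_representatives`, `definable_of_invariant`).
An open subgroup `V` is then the stabiliser of an imaginary, and weak elimination of imaginaries
yields a finite set `C` whose pointwise stabiliser lies in `V` and whose points have finite
`V`-orbits (`exists_tuple_of_stabilizer_le`). The forward direction uses only these two properties
of the permutation group, together with continuity.

Write `G_A` for the pointwise stabiliser of a finite algebraically closed set `A`, and `P_A` for the
projection onto the `G_A`-fixed vectors. The heart is `starProjection_mem_invariants_inter`: `P_B`
sends `G_A`-fixed vectors to `G_{A ∩ B}`-fixed ones. A `G_A`-fixed `ξ` has finitely many matrix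
coefficients, so inner products on the weak closure of its orbit take finitely many values. This
makes the weak closure stable under every `P_A`, and it makes the norms along alternating
projections stabilise, so `P_B ξ` is fixed by both `G_A` and `G_B`. The finite set `C` belonging to
the stabiliser of `P_B ξ` then lies in `A ∩ B`. It follows that the space is the Hilbert sum of the
spaces `newVectors π A`, which the group permutes.

If there are no invariant vectors, the squared norms of the components of an almost invariant unit
vector form a probability measure on those `A` that meet `X₀`. Spreading each mass uniformly over `A
∩ X₀` gives an almost invariant function in `ℓ¹₊(X₀)` (`ellOneConstant_le_of_almost_invariant`).
Conversely, `ℓ²(X₀)` has no invariant vectors when the orbits are infinite, while `√f` is almost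
invariant whenever `f` is (`ellOneConstant_pos_of_isKazhdanPair`). -/

namespace KazhdanOligomorphic

/-! ### Sequences built by extending finite initial segments. -/

section Sequences

/-- Recursive construction of a sequence all of whose initial segments have a property that can
always be maintained. -/
theorem exists_seq_of_extension {α : Type*} (good : ∀ t : ℕ, (Fin t → α) → Prop)
    (P : ∀ t : ℕ, (Fin t → α) → α → Prop) (h0 : good 0 Fin.elim0)
    (hs : ∀ t v, good t v → ∃ a, P t v a ∧ good (t + 1) (Fin.snoc v a)) :
    ∃ y : ℕ → α, ∀ t, good t (fun i => y i) ∧ P t (fun i => y i) (y t) := by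
  have : Nonempty α := ⟨(hs 0 _ h0).choose⟩
  choose! nxt hP hg using hs
  let s : ∀ t : ℕ, (Fin t → α) := fun t =>
    Nat.rec (motive := fun t => Fin t → α) Fin.elim0 (fun t v => Fin.snoc v (nxt t v)) t
  have hsucc : ∀ t, s (t + 1) = Fin.snoc (s t) (nxt t (s t)) := fun t => rfl
  have hgood : ∀ t, good t (s t) := by
    intro t
    induction t with
    | zero => exact h0
    | succ t ih => rw [hsucc]; exact hg t _ ih
  have hs' : ∀ t, s t = fun i : Fin t => nxt i (s i) := by
    intro t
    induction t with
    | zero => funext i; exact i.elim0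
    | succ t ih =>
      rw [hsucc]
      funext i
      refine Fin.lastCases ?_ (fun j => ?_) i
      · simp
      · rw [Fin.snoc_castSucc]
        exact congrFun ih j
  refine ⟨fun t => nxt t (s t), fun t => ?_⟩
  rw [← hs' t]
  exact ⟨hgood t, hP t _ (hgood t)⟩

end Sequences

/-! ### Countable saturation over the empty set. -/

section Saturation

open FirstOrder FirstOrder.Language Cardinal

variable {L : FirstOrder.Language.{u, v}} {X : Type w} [L.Structure X]

theorem exists_mem_iInter_of_antitone_of_finite {α : Type*} [Finite α] (S : ℕ → Set α)
    (hS : Antitone S) (hne : ∀ n, (S n).Nonempty) : ∃ a, ∀ n, a ∈ S n := by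
  choose a ha using hne
  obtain ⟨b, hb⟩ := Finite.exists_infinite_fiber a
  refine ⟨b, fun n => ?_⟩
  obtain ⟨m, hm, hnm⟩ := (Set.infinite_coe_iff.1 hb).exists_gt n
  have : a m = b := hm
  exact this ▸ hS hnm.le (ha m)

/-- A decreasing sequence of satisfiable formulas is realised in some countably infinite model. -/
theorem exists_model_realize [Countable L.Symbols] [Infinite X] {ι : Type} [Finite ι]
    (φ : ℕ → L.Formula ι)
    (h : ∀ n, ∃ a : ι → X, ∀ m ≤ n, (φ m).Realize a) :
    ∃ N : (L.completeTheory X).ModelType, #N = aleph0.{w} ∧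
      ∃ a : ι → N, ∀ n, (φ n).Realize a := by
  set T : L[[ι]].Theory := (L.lhomWithConstants ι).onTheory (L.completeTheory X) ∪
    Set.range fun n => Formula.equivSentence (φ n) with hT
  have hsat : T.IsSatisfiable := by
    rw [Theory.isSatisfiable_iff_isFinitelySatisfiable]
    intro T0 hT0
    have hb : ∃ n, ∀ ψ ∈ T0, ψ ∈ (L.lhomWithConstants ι).onTheory (L.completeTheory X) ∨
        ∃ m ≤ n, Formula.equivSentence (φ m) = ψ := by
      have h1 : ∀ ψ ∈ T0, ∃ n, ψ ∈ (L.lhomWithConstants ι).onTheory (L.completeTheory X) ∨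
          ∃ m ≤ n, Formula.equivSentence (φ m) = ψ := by
        intro ψ hψ
        rcases hT0 hψ with h2 | ⟨m, rfl⟩
        · exact ⟨0, Or.inl h2⟩
        · exact ⟨m, Or.inr ⟨m, le_rfl, rfl⟩⟩
      choose! f hf using h1
      refine ⟨T0.sup f, fun ψ hψ => ?_⟩
      rcases hf ψ hψ with h2 | ⟨m, hm, h2⟩
      · exact Or.inl h2
      · exact Or.inr ⟨m, hm.trans (Finset.le_sup hψ), h2⟩
    obtain ⟨n, hn⟩ := hb
    obtain ⟨a, ha⟩ := h n
    let : (constantsOn ι).Structure X := constantsOn.structure a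
    have : X ⊨ (T0 : L[[ι]].Theory) := by
      refine ⟨fun ψ hψ => ?_⟩
      rcases hn ψ hψ with h2 | ⟨m, hm, rfl⟩
      · have : X ⊨ (L.lhomWithConstants ι).onTheory (L.completeTheory X) :=
          (LHom.onTheory_model _ _).2 inferInstance
        exact this.realize_of_mem _ h2
      · exact (Formula.realize_equivSentence X (φ m)).2 (ha m hm)
    exact Theory.Model.isSatisfiable X
  obtain ⟨M⟩ := hsat
  have hTM : (L.lhomWithConstants ι).onTheory (L.completeTheory X) ⊆ T := Set.subset_union_left
  have hMinf : Infinite M := by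
    let M' := (M.subtheoryModel hTM).reduct (L.lhomWithConstants ι)
    have h1 : X ≅[L] M' := by
      rw [elementarilyEquivalent_iff]
      intro ψ
      by_cases hψ : X ⊨ ψ
      · exact ⟨fun _ => M'.is_model.realize_of_mem _ hψ, fun _ => hψ⟩
      · have : M' ⊨ ψ.not := M'.is_model.realize_of_mem _ ((Sentence.realize_not X).2 hψ)
        exact ⟨fun h => absurd h hψ, fun h => absurd h ((Sentence.realize_not _).1 this)⟩
    exact (ElementarilyEquivalent.infinite_iff h1).1 inferInstance
  have hcard : L[[ι]].card ≤ ℵ₀ := mk_le_aleph0_iff.2 (inferInstance : Countable L[[ι]].Symbols)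
  obtain ⟨N, hN⟩ := Theory.exists_model_card_eq ⟨M, hMinf⟩ aleph0.{w} le_rfl (by
    rw [lift_aleph0]
    exact (lift_le_aleph0).2 hcard)
  let N' := (N.subtheoryModel hTM).reduct (L.lhomWithConstants ι)
  refine ⟨N', hN, fun i => (L.con i : N), fun n => ?_⟩
  have h2 : N ⊨ Formula.equivSentence (φ n) :=
    N.is_model.realize_of_mem _ (Or.inr ⟨n, rfl⟩)
  let : L.Structure N := (L.lhomWithConstants ι).reduct N
  exact (Formula.realize_equivSentence N (φ n)).1 h2

theorem realize_comp_equiv_iff {M N : Type*} [L.Structure M] [L.Structure N]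
    (e : M ≃[L] N) {ι : Type*} (φ : L.Formula ι) (a : ι → M) :
    φ.Realize (fun i => e (a i)) ↔ φ.Realize a := by
  exact (StrongHomClass.realize_formula e φ)

/-- An `ω`-categorical structure realises every consistent countable partial type over `∅`. -/
theorem exists_mem_iInter_of_definable [Countable L.Symbols] (hcat : IsOmegaCategorical L X)
    {ι : Type} [Finite ι] (S : ℕ → Set (ι → X)) (hS : Antitone S)
    (hd : ∀ n, (∅ : Set X).Definable L (S n)) (hne : ∀ n, (S n).Nonempty) :
    ∃ a, ∀ n, a ∈ S n := by
  rcases finite_or_infinite X with hX | hX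
  · exact exists_mem_iInter_of_antitone_of_finite S hS hne
  · simp only [Set.empty_definable_iff] at hd
    choose φ hφ using hd
    have hmem : ∀ n a, a ∈ S n ↔ (φ n).Realize a := fun n a => by rw [hφ n]; rfl
    obtain ⟨N, hN, a, ha⟩ := exists_model_realize (X := X) φ (fun n => by
      obtain ⟨a, ha⟩ := hne n
      exact ⟨a, fun m hm => (hmem m a).1 (hS hm ha)⟩)
    have := hcat.1
    obtain ⟨e⟩ := hcat.2 N (Theory.ModelType.of (L.completeTheory X) X) hN (mk_eq_aleph0 X)
    exact ⟨fun i => e (a i), fun n =>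
      (hmem n _).2 ((realize_comp_equiv_iff (N := X) e (φ n) a).2 (ha n))⟩

end Saturation

/-! ### Isolated types: every tuple of `X` realises one. -/

section Atoms

open FirstOrder FirstOrder.Language Cardinal

variable (L : FirstOrder.Language.{u, v}) {X : Type w} [L.Structure X] {ι κ : Type}

/-- An atom of the Boolean algebra of `∅`-definable subsets of `X ^ ι`. -/
def IsAtomSet (S : Set (ι → X)) : Prop :=
  (∅ : Set X).Definable L S ∧ S.Nonempty ∧
    ∀ T, (∅ : Set X).Definable L T → (S ∩ T).Nonempty → S ⊆ T

/-- A tuple whose type is isolated. -/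
def IsIsolated (a : ι → X) : Prop :=
  ∃ S, IsAtomSet L S ∧ a ∈ S

/-- Two tuples satisfy the same formulas. -/
def SameType (a b : ι → X) : Prop :=
  ∀ T, (∅ : Set X).Definable L T → (a ∈ T ↔ b ∈ T)

variable {L}

theorem IsAtomSet.sameType {S : Set (ι → X)} (hS : IsAtomSet L S) {a b : ι → X}
    (ha : a ∈ S) (hb : b ∈ S) : SameType L a b := fun T hT =>
  ⟨fun h => hS.2.2 T hT ⟨a, ha, h⟩ hb, fun h => hS.2.2 T hT ⟨b, hb, h⟩ ha⟩

/-- Without an atom below `S`, one could shrink `S` step by step so as to avoid each of the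
countably many tuples of `X`; the resulting decreasing sequence of definable sets would have empty
intersection, against saturation. -/
theorem exists_isAtomSet_subset [Countable L.Symbols] (hcat : IsOmegaCategorical L X) [Finite ι]
    {S : Set (ι → X)} (hS : (∅ : Set X).Definable L S) (hne : S.Nonempty) :
    ∃ T ⊆ S, IsAtomSet L T := by
  by_contra! hcon
  have := hcat.1
  have : Nonempty (ι → X) := ⟨hne.some⟩
  obtain ⟨e, he⟩ := exists_surjective_nat (ι → X)
  let D := {T : Set (ι → X) // T ⊆ S ∧ (∅ : Set X).Definable L T ∧ T.Nonempty}
  -- As `T` is not an atom, a definable `U` splits it, and one of the two pieces misses `a`.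
  have hstep : ∀ (T : D) (a : ι → X), ∃ T' : D, T'.1 ⊆ T.1 ∧ a ∉ T'.1 := by
    rintro ⟨T, hTS, hT, hTne⟩ a
    have h1 := hcon T hTS
    simp only [IsAtomSet, not_and, not_forall] at h1
    obtain ⟨U, hU, hTU, hnot⟩ := h1 hT hTne
    by_cases ha : a ∈ U
    · refine ⟨⟨T \ U, Set.sdiff_subset.trans hTS, hT.sdiff hU, ?_⟩, Set.sdiff_subset, fun h => h.2 ha⟩
      obtain ⟨b, hb, hbU⟩ := Set.not_subset.1 hnot
      exact ⟨b, hb, hbU⟩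
    · exact ⟨⟨T ∩ U, Set.inter_subset_left.trans hTS, hT.inter hU, hTU⟩, Set.inter_subset_left,
        fun h => ha h.2⟩
  choose f hf hfa using hstep
  let s : ℕ → D := fun n => Nat.rec ⟨S, subset_rfl, hS, hne⟩ (fun n T => f T (e n)) n
  have hs : ∀ n, s (n + 1) = f (s n) (e n) := fun n => rfl
  obtain ⟨a, ha⟩ := exists_mem_iInter_of_definable hcat (fun n => (s n).1)
    (antitone_nat_of_succ_le fun n => by rw [hs]; exact hf _ _)
    (fun n => (s n).2.2.1) (fun n => (s n).2.2.2)
  obtain ⟨n, rfl⟩ := he a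
  have := ha (n + 1)
  simp only [hs] at this
  exact hfa _ _ this

theorem IsAtomSet.image_comp [Finite ι] [Finite κ] {S : Set (ι → X)} (hS : IsAtomSet L S)
    (f : κ → ι) : IsAtomSet L ((fun a : ι → X => a ∘ f) '' S) := by
  refine ⟨hS.1.image_comp f, hS.2.1.image _, fun T hT hne => ?_⟩
  obtain ⟨_, ⟨a, ha, rfl⟩, haT⟩ := hne
  have := hS.2.2 _ (hT.preimage_comp f) ⟨a, ha, haT⟩
  rintro _ ⟨b, hb, rfl⟩
  exact this hb

theorem IsIsolated.comp [Finite ι] [Finite κ] {a : ι → X} (ha : IsIsolated L a) (f : κ → ι) :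
    IsIsolated L (a ∘ f) := by
  obtain ⟨S, hS, haS⟩ := ha
  exact ⟨_, hS.image_comp f, ⟨a, haS, rfl⟩⟩

/-- Isolated tuples can be extended to isolated tuples inside a given definable set. -/
theorem IsIsolated.exists_extension [Countable L.Symbols] (hcat : IsOmegaCategorical L X)
    [Finite ι] [Finite κ] (f : κ → ι) {a : κ → X} (ha : IsIsolated L a)
    {S : Set (ι → X)} (hS : (∅ : Set X).Definable L S) {b : ι → X} (hb : b ∈ S) (hba : b ∘ f = a) :
    ∃ b', b' ∈ S ∧ b' ∘ f = a ∧ IsIsolated L b' := by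
  obtain ⟨A, hA, haA⟩ := ha
  obtain ⟨T, hTS, hT⟩ := exists_isAtomSet_subset hcat (hS.inter (hA.1.preimage_comp f))
    ⟨b, hb, by change b ∘ f ∈ A; rwa [hba]⟩
  -- The projection of `T` meets the atom `A`, so it contains `A` and in particular `a`.
  have h1 := hA.2.2 _ (hT.image_comp f).1 (by
    obtain ⟨c, hc⟩ := hT.2.1
    exact ⟨c ∘ f, (hTS hc).2, ⟨c, hc, rfl⟩⟩)
  obtain ⟨b', hb', hb'a⟩ := h1 haA
  exact ⟨b', (hTS hb').1, hb'a, T, hT, hb'⟩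

theorem isIsolated_of_finite [Finite X] [Finite ι] (a : ι → X) : IsIsolated L a := by
  obtain ⟨S, ⟨hS, haS⟩, hmin⟩ := (wellFounded_lt (α := Set (ι → X))).has_min
    {S | (∅ : Set X).Definable L S ∧ a ∈ S} ⟨Set.univ, Set.definable_univ, trivial⟩
  have key : ∀ T, (∅ : Set X).Definable L T → a ∈ T → S ⊆ T := by
    intro T hT haT
    by_contra hnot
    refine hmin (S ∩ T) ⟨hS.inter hT, haS, haT⟩ ?_
    exact Set.inter_ssubset_left_iff.2 hnot
  refine ⟨S, ⟨hS, ⟨a, haS⟩, fun T hT hne => ?_⟩, haS⟩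
  by_cases haT : a ∈ T
  · exact key T hT haT
  · obtain ⟨b, hbS, hbT⟩ := hne
    exact absurd hbT (key Tᶜ hT.compl haT hbS)

/-- The task solved at each step of the construction of an atomic elementary substructure. -/
theorem exists_isolated_snoc [Countable L.Symbols] (hcat : IsOmegaCategorical L X) [Nonempty X]
    {k t : ℕ} (hkt : k ≤ t) {S : Set (Fin (k + 1) → X)} (hS : (∅ : Set X).Definable L S)
    (v : Fin t → X) (hv : IsIsolated L v) :
    ∃ a, ((∃ a', Fin.snoc (α := fun _ => X) (v ∘ Fin.castLE hkt) a' ∈ S) →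
        Fin.snoc (α := fun _ => X) (v ∘ Fin.castLE hkt) a ∈ S) ∧
      IsIsolated L (Fin.snoc (α := fun _ => X) v a) := by
  let r : Fin (k + 1) → Fin (t + 1) :=
    Fin.snoc (α := fun _ => Fin (t + 1)) (fun i => (Fin.castLE hkt i).castSucc) (Fin.last t)
  have hr : ∀ a : X, (Fin.snoc (α := fun _ => X) v a) ∘ r =
      Fin.snoc (α := fun _ => X) (v ∘ Fin.castLE hkt) a := by
    intro a
    funext i
    refine Fin.lastCases ?_ (fun j => ?_) i
    · simp [r]
    · simp only [r, Function.comp_apply, Fin.snoc_castSucc]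
  have hext : ∀ b : Fin (t + 1) → X, b ∘ Fin.castSucc = v →
      b = Fin.snoc (α := fun _ => X) v (b (Fin.last t)) := by
    rintro b rfl
    exact (Fin.snoc_init_self b).symm
  have hsn : ∀ a : X, (Fin.snoc (α := fun _ => X) v a) ∘ Fin.castSucc = v := by
    intro a; funext i; simp
  by_cases h : ∃ a', Fin.snoc (α := fun _ => X) (v ∘ Fin.castLE hkt) a' ∈ S
  · obtain ⟨a', ha'⟩ := h
    obtain ⟨b, hb, hbv, hbi⟩ := hv.exists_extension hcat Fin.castSucc (hS.preimage_comp r)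
      (b := Fin.snoc (α := fun _ => X) v a') (by change _ ∘ r ∈ S; rwa [hr]) (hsn a')
    rw [hext b hbv] at hb hbi
    refine ⟨b (Fin.last t), fun _ => ?_, hbi⟩
    rw [← hr]
    exact hb
  · obtain ⟨b, -, hbv, hbi⟩ := hv.exists_extension hcat Fin.castSucc
      (S := (Set.univ : Set (Fin (t + 1) → X))) Set.definable_univ
      (b := Fin.snoc (α := fun _ => X) v (Classical.arbitrary X)) trivial (hsn _)
    rw [hext b hbv] at hbi
    exact ⟨_, fun h' => absurd h' h, hbi⟩

instance countable_definable [Countable L.Symbols] [Countable ι] :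
    Countable {S : Set (ι → X) // (∅ : Set X).Definable L S} := by
  have h : ∀ S : {S : Set (ι → X) // (∅ : Set X).Definable L S},
      ∃ φ : L.Formula ι, S.1 = Set.ofPred φ.Realize := fun S => Set.empty_definable_iff.1 S.2
  choose f hf using h
  refine Function.Injective.countable (f := f) fun S T hST => Subtype.ext ?_
  rw [hf S, hf T, hST]

/-- A sequence whose finite subtuples are isolated and which satisfies the Tarski–Vaught test. -/
theorem exists_isolated_sequence [Countable L.Symbols] (hcat : IsOmegaCategorical L X)
    [Nonempty X] : ∃ y : ℕ → X, (∀ (n : ℕ) (i : Fin n → ℕ), IsIsolated L (y ∘ i)) ∧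
      ∀ (n : ℕ) (S : Set (Fin (n + 1) → X)), (∅ : Set X).Definable L S → ∀ (i : Fin n → ℕ) (a : X),
        Fin.snoc (α := fun _ => X) (y ∘ i) a ∈ S →
        ∃ j, Fin.snoc (α := fun _ => X) (y ∘ i) (y j) ∈ S := by
  let Tasks := Σ k : ℕ, {S : Set (Fin (k + 1) → X) // (∅ : Set X).Definable L S}
  have : Nonempty Tasks := ⟨⟨0, Set.univ, Set.definable_univ⟩⟩
  obtain ⟨e, he⟩ := exists_surjective_nat Tasks
  -- Each task `e m` recurs at every stage `Nat.pair m k`. Since `k ≤ Nat.pair m k`, one of these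
  -- stages comes when the parameters of the task have already been chosen.
  let task : ℕ → Tasks := fun t => e (Nat.unpair t).1
  obtain ⟨y, hy⟩ := exists_seq_of_extension (α := X) (fun t v => IsIsolated L v)
    (fun t v a => ∀ hkt : (task t).1 ≤ t,
      (∃ a', Fin.snoc (α := fun _ => X) (v ∘ Fin.castLE hkt) a' ∈ (task t).2.1) →
        Fin.snoc (α := fun _ => X) (v ∘ Fin.castLE hkt) a ∈ (task t).2.1)
    (by
      refine ⟨Set.univ, ⟨Set.definable_univ, ⟨Fin.elim0, trivial⟩, fun T _ hne b _ => ?_⟩, trivial⟩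
      obtain ⟨c, -, hc⟩ := hne
      rwa [Subsingleton.elim b c])
    (fun t v hv => by
      by_cases hkt : (task t).1 ≤ t
      · obtain ⟨a, ha, hi⟩ := exists_isolated_snoc hcat hkt (task t).2.2 v hv
        exact ⟨a, fun _ => ha, hi⟩
      · obtain ⟨a, -, hi⟩ := exists_isolated_snoc hcat (Nat.zero_le t)
          (S := Set.univ) Set.definable_univ v hv
        exact ⟨a, fun h => absurd h hkt, hi⟩)
  refine ⟨y, fun n i => ?_, fun n S hS i a ha => ?_⟩
  · let t := Finset.univ.sup i + 1
    have hi : ∀ j, i j < t := fun j => Nat.lt_succ_of_le (Finset.le_sup (Finset.mem_univ j))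
    exact (hy t).1.comp fun j => ⟨i j, hi j⟩
  · let k := Finset.univ.sup i + 1
    have hi : ∀ j, i j < k := fun j => Nat.lt_succ_of_le (Finset.le_sup (Finset.mem_univ j))
    let r : Fin (n + 1) → Fin (k + 1) :=
      Fin.snoc (α := fun _ => Fin (k + 1)) (fun j => (⟨i j, hi j⟩ : Fin k).castSucc) (Fin.last k)
    have hr : ∀ b : X, (Fin.snoc (α := fun _ => X) (fun j : Fin k => y j) b) ∘ r =
        Fin.snoc (α := fun _ => X) (y ∘ i) b := by
      intro b
      funext j
      refine Fin.lastCases ?_ (fun j => ?_) j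
      · simp [r]
      · simp only [r, Function.comp_apply, Fin.snoc_castSucc]
    obtain ⟨m, hm⟩ := he ⟨k, (fun b => b ∘ r) ⁻¹' S, hS.preimage_comp r⟩
    obtain ⟨-, h2⟩ := hy (Nat.pair m k)
    have ht : task (Nat.pair m k) = ⟨k, (fun b => b ∘ r) ⁻¹' S, hS.preimage_comp r⟩ := by
      simp [task, hm]
    rw [ht] at h2
    have h3 := h2 (Nat.right_le_pair m k) ⟨a, by
      change (Fin.snoc (α := fun _ => X) (fun j : Fin k => y j) a) ∘ r ∈ S
      rwa [hr]⟩
    refine ⟨Nat.pair m k, ?_⟩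
    rw [← hr]
    exact h3

/-- Every tuple of an `ω`-categorical structure has an isolated type. -/
theorem isIsolated_of_isOmegaCategorical [Countable L.Symbols] (hcat : IsOmegaCategorical L X)
    (n : ℕ) (a : Fin n → X) : IsIsolated L a := by
  rcases finite_or_infinite X with hX | hX
  · exact isIsolated_of_finite a
  obtain ⟨y, hiso, hTV⟩ := exists_isolated_sequence hcat (L := L) (X := X)
  let Y : L.Substructure X :=
    { carrier := Set.range y
      fun_mem := fun {n} F b hb => by
        choose i hi using hb
        obtain ⟨j, hj⟩ := hTV n {c : Fin (n + 1) → X |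
            c (Fin.last n) = Structure.funMap F (c ∘ Fin.castSucc)} (by
          rw [Set.empty_definable_iff]
          refine ⟨(Term.var (Fin.last n)).equal (Term.func F fun j => Term.var j.castSucc), ?_⟩
          ext c
          simp [Formula.realize_equal, Function.comp_def]) i (Structure.funMap F (y ∘ i)) (by
            simp [Function.comp_def])
        refine ⟨j, ?_⟩
        have hyb : y ∘ i = b := funext hi
        simpa [Function.comp_def, ← hyb] using hj }
  have hYmem : ∀ b : Y, ∃ i, y i = b := fun b => b.2
  have hY : Y.IsElementary := by
    refine Y.isElementary_of_exists fun n φ b a ha => ?_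
    choose i hi using fun j => hYmem (b j)
    have hyb : y ∘ i = (↑) ∘ b := funext hi
    obtain ⟨j, hj⟩ := hTV n {c | φ.Realize default c} (by
      rw [Set.empty_definable_iff]
      refine ⟨(φ.toFormula.relabel (Sum.elim Empty.elim id)), ?_⟩
      ext c
      simp only [Set.mem_ofPred_eq, Formula.realize_relabel, BoundedFormula.realize_toFormula]
      rw [iff_iff_eq]
      congr 1
      exact Subsingleton.elim _ _) i a (by rw [hyb]; exact ha)
    refine ⟨⟨y j, j, rfl⟩, ?_⟩
    rw [hyb] at hj
    exact hj
  let Y' : L.ElementarySubstructure X := ⟨Y, hY⟩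
  have hequiv := Y'.elementarilyEquivalent
  have : Infinite Y' := hequiv.infinite_iff.2 hX
  have : Countable Y' := (Set.countable_range y).to_subtype
  have := hcat.1
  -- Categoricity identifies the atomic elementary substructure with `X`, so all tuples of `X` are
  -- isolated.
  obtain ⟨e⟩ := hcat.2 (Theory.ModelType.of (L.completeTheory X) Y')
    (Theory.ModelType.of (L.completeTheory X) X) (mk_eq_aleph0 Y') (mk_eq_aleph0 X)
  let e' : Y' ≃[L] X := e
  choose i hi using fun j => hYmem (e'.symm (a j))
  obtain ⟨S, hS, hyS⟩ := hiso n i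
  refine ⟨S, hS, ?_⟩
  obtain ⟨φ, hφ⟩ := Set.empty_definable_iff.1 hS.1
  have h1 : φ.Realize (y ∘ i) := by rw [hφ] at hyS; exact hyS
  have h2 : y ∘ i = (Y'.subtype : Y' → X) ∘ fun j => e'.symm (a j) := funext hi
  rw [h2, Y'.subtype.map_formula] at h1
  have h3 := (realize_comp_equiv_iff e' φ _).2 h1
  have h4 : (fun j => e' (e'.symm (a j))) = a := funext fun j => e'.apply_symm_apply _
  rw [h4] at h3
  rw [hφ]
  exact h3

end Atoms

/-! ### Types are orbits, and open subgroups come from finite tuples. -/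

section Orbits

open FirstOrder FirstOrder.Language Cardinal

variable {L : FirstOrder.Language.{u, v}} {X : Type w} [L.Structure X] {ι κ : Type}

theorem IsIsolated.of_isOmegaCategorical [Countable L.Symbols] (hcat : IsOmegaCategorical L X)
    [Finite ι] (a : ι → X) : IsIsolated L a := by
  obtain ⟨n, ⟨e⟩⟩ := Finite.exists_equiv_fin ι
  have := (isIsolated_of_isOmegaCategorical hcat n (a ∘ e.symm)).comp e
  rwa [Function.comp_assoc, e.symm_comp_self, Function.comp_id] at this

theorem SameType.symm {a b : ι → X} (h : SameType L a b) : SameType L b a :=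
  fun T hT => (h T hT).symm

theorem SameType.comp {a b : ι → X} (h : SameType L a b) (f : κ → ι) :
    SameType L (a ∘ f) (b ∘ f) := fun _ hT => h _ (hT.preimage_comp f)

/-- The atom of `a` projects to a definable set that contains `a ∘ f`, hence also `b`; any point of
the atom above `b` will do. This homogeneity drives the back-and-forth. -/
theorem SameType.lift [Countable L.Symbols] (hcat : IsOmegaCategorical L X) [Finite ι] [Finite κ]
    (f : κ → ι) {a : ι → X} {b : κ → X} (h : SameType L (a ∘ f) b) :
    ∃ b' : ι → X, b' ∘ f = b ∧ SameType L a b' := by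
  obtain ⟨S, hS, haS⟩ := IsIsolated.of_isOmegaCategorical hcat a
  obtain ⟨b', hb', hb⟩ := (h _ (hS.image_comp f).1).1 ⟨a, haS, rfl⟩
  exact ⟨b', hb, hS.sameType haS hb'⟩

theorem SameType.apply_eq_iff {a b : ι → X} (h : SameType L a b) (i j : ι) :
    a i = a j ↔ b i = b j := by
  refine h {c | c i = c j} ?_
  rw [Set.empty_definable_iff]
  refine ⟨(Term.var i).equal (Term.var j), ?_⟩
  ext c
  simp [Formula.realize_equal]

/-- A permutation preserving the types of all finite tuples is an automorphism. -/
def autOfSameType (g : X ≃ X) (hg : ∀ (n : ℕ) (a : Fin n → X), SameType L a (g ∘ a)) :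
    Aut L X where
  toEquiv := g
  map_fun' {n} f a := by
    have h := hg (n + 1) (Fin.snoc (α := fun _ => X) a (Structure.funMap f a))
      {c | c (Fin.last n) = Structure.funMap f (c ∘ Fin.castSucc)} (by
        rw [Set.empty_definable_iff]
        refine ⟨(Term.var (Fin.last n)).equal (Term.func f fun j => Term.var j.castSucc), ?_⟩
        ext c
        simp [Formula.realize_equal, Function.comp_def])
    simpa [Function.comp_def] using h
  map_rel' {n} r a := by
    refine (hg n a {c | Structure.RelMap r c} ?_).symm
    rw [Set.empty_definable_iff]
    refine ⟨r.formula fun j => Term.var j, ?_⟩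
    ext c
    simp [Formula.realize_rel]

/-- One step of the back-and-forth construction. -/
theorem SameType.exists_snoc [Countable L.Symbols] (hcat : IsOmegaCategorical L X)
    [Finite ι] {a b : ι → X} {t : ℕ} {v w : Fin t → X}
    (h : SameType L (Sum.elim a v) (Sum.elim b w)) (c : X) :
    ∃ d, SameType L (Sum.elim a (Fin.snoc (α := fun _ => X) v c))
      (Sum.elim b (Fin.snoc (α := fun _ => X) w d)) := by
  obtain ⟨b', hb', hs⟩ := SameType.lift hcat
    (Sum.map id Fin.castSucc : ι ⊕ Fin t → ι ⊕ Fin (t + 1))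
    (a := Sum.elim a (Fin.snoc (α := fun _ => X) v c)) (b := Sum.elim b w) (by
      convert h using 1
      funext i
      rcases i with i | i <;> simp)
  refine ⟨b' (Sum.inr (Fin.last t)), ?_⟩
  convert hs using 1
  funext i
  rcases i with i | i
  · exact (congrFun hb' (Sum.inl i)).symm
  · refine Fin.lastCases ?_ (fun j => ?_) i
    · simp
    · simpa using (congrFun hb' (Sum.inr j)).symm

/-- Tuples of the same type are conjugate under the automorphism group. -/
theorem SameType.exists_aut [Countable L.Symbols] (hcat : IsOmegaCategorical L X)
    [Finite ι] {a b : ι → X} (hab : SameType L a b) :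
    ∃ g : Aut L X, ∀ i, g • a i = b i := by
  rcases isEmpty_or_nonempty X with hX | hX
  · exact ⟨1, fun i => hX.elim (a i)⟩
  have := hcat.1
  obtain ⟨e, he⟩ := exists_surjective_nat X
  obtain ⟨y, hy⟩ := exists_seq_of_extension (α := X × X)
    (fun t v => SameType L (Sum.elim a (fun i => (v i).1)) (Sum.elim b (fun i => (v i).2)))
    -- Even stages put the next element into the domain, odd stages into the range.
    (fun t v p => (t % 2 = 0 → p.1 = e (t / 2)) ∧ (t % 2 = 1 → p.2 = e (t / 2)))
    (by
      have hc := hab.comp (Sum.elim id Fin.elim0 : ι ⊕ Fin 0 → ι)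
      convert hc using 1 <;>
      · funext i
        rcases i with i | i
        · rfl
        · exact i.elim0)
    (fun t v hv => by
      have hs : ∀ p : X × X, (fun i => (Fin.snoc (α := fun _ => X × X) v p i).1) =
            Fin.snoc (α := fun _ => X) (fun i => (v i).1) p.1 ∧
          (fun i => (Fin.snoc (α := fun _ => X × X) v p i).2) =
            Fin.snoc (α := fun _ => X) (fun i => (v i).2) p.2 := by
        intro p
        constructor <;>
        · funext i
          refine Fin.lastCases ?_ (fun j => ?_) i <;> simp
      rcases Nat.mod_two_eq_zero_or_one t with ht | ht
      · obtain ⟨d, hd⟩ := hv.exists_snoc hcat (e (t / 2))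
        refine ⟨(e (t / 2), d), ⟨fun _ => rfl, fun h => by omega⟩, ?_⟩
        rw [(hs _).1, (hs _).2]
        exact hd
      · obtain ⟨d, hd⟩ := hv.symm.exists_snoc hcat (e (t / 2))
        refine ⟨(d, e (t / 2)), ⟨fun h => by omega, fun _ => rfl⟩, ?_⟩
        rw [(hs _).1, (hs _).2]
        exact hd.symm)
  have hcomp : ∀ {n : ℕ} (i : Fin n → ℕ), SameType L (Sum.elim a fun j => (y (i j)).1)
      (Sum.elim b fun j => (y (i j)).2) := by
    intro n i
    let t := Finset.univ.sup i + 1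
    have hi : ∀ j, i j < t := fun j => Nat.lt_succ_of_le (Finset.le_sup (Finset.mem_univ j))
    have := (hy t).1.comp (Sum.map id (fun j => ⟨i j, hi j⟩) : ι ⊕ Fin n → ι ⊕ Fin t)
    convert this using 1 <;>
    · funext j
      rcases j with j | j <;> rfl
  have hiff : ∀ m n, (y m).1 = (y n).1 ↔ (y m).2 = (y n).2 := fun m n =>
    (hcomp ![m, n]).apply_eq_iff (Sum.inr 0) (Sum.inr 1)
  have hiff' : ∀ i n, a i = (y n).1 ↔ b i = (y n).2 := fun i n =>
    (hcomp ![n]).apply_eq_iff (Sum.inl i) (Sum.inr 0)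
  have h1 : ∀ c, ∃ n, (y n).1 = c := by
    intro c
    obtain ⟨n, rfl⟩ := he c
    refine ⟨2 * n, ?_⟩
    have := (hy (2 * n)).2.1 (by omega)
    rwa [show 2 * n / 2 = n by omega] at this
  have h2 : ∀ c, ∃ n, (y n).2 = c := by
    intro c
    obtain ⟨n, rfl⟩ := he c
    refine ⟨2 * n + 1, ?_⟩
    have := (hy (2 * n + 1)).2.2 (by omega)
    rwa [show (2 * n + 1) / 2 = n by omega] at this
  choose p hp using h1
  choose q hq using h2
  let g : X ≃ X :=
    { toFun := fun c => (y (p c)).2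
      invFun := fun c => (y (q c)).1
      left_inv := fun c => by
        rw [← hp c]
        refine (hiff _ _).2 ?_
        rw [hq, hp]
      right_inv := fun c => by
        change (y (p (y (q c)).1)).2 = c
        nth_rw 2 [← hq c]
        refine (hiff _ _).1 ?_
        rw [hp] }
  refine ⟨autOfSameType g fun n c => ?_, fun i => ?_⟩
  · have := (hcomp (p ∘ c)).comp (Sum.inr : Fin n → ι ⊕ Fin n)
    convert this using 1
    · funext j
      exact (hp (c j)).symm
    · rfl
  · change (y (p (a i))).2 = b i
    exact ((hiff' i _).1 (hp (a i)).symm).symm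

theorem sameType_smul (g : Aut L X) (a : ι → X) : SameType L a (g • a) := by
  intro T hT
  obtain ⟨φ, rfl⟩ := Set.empty_definable_iff.1 hT
  exact (realize_comp_equiv_iff (g : X ≃[L] X) φ a).symm

/-- The action of the automorphism group of an `ω`-categorical structure is oligomorphic. -/
theorem exists_finite_orbit_representatives [Countable L.Symbols] (hcat : IsOmegaCategorical L X)
    [Finite ι] : ∃ F : Set (ι → X), F.Finite ∧ ∀ a, ∃ b ∈ F, ∃ g : Aut L X, g • b = a := by
  rcases isEmpty_or_nonempty (ι → X) with hX | hX
  · exact ⟨∅, Set.finite_empty, fun a => hX.elim a⟩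
  have := hcat.1
  obtain ⟨e, he⟩ := exists_surjective_nat (ι → X)
  have hiso := fun n => IsIsolated.of_isOmegaCategorical hcat (e n)
  choose S hS heS using hiso
  -- Finitely many atoms cover: otherwise saturation provides a tuple outside all the `S m`, but
  -- each tuple lies in its own atom.
  have hex : ∃ n, ∀ a, ∃ m ∈ Finset.range n, a ∈ S m := by
    by_contra! hcon
    obtain ⟨a, ha⟩ := exists_mem_iInter_of_definable hcat
      (fun n => ⋂ m ∈ Finset.range n, (S m)ᶜ)
      (fun m n hmn => Set.biInter_subset_biInter_left fun i hi =>
        Finset.mem_range.2 ((Finset.mem_range.1 hi).trans_le hmn))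
      (fun n => Set.definable_biInter_finset (fun m => (hS m).1.compl) _)
      (fun n => by
        obtain ⟨a, ha⟩ := hcon n
        exact ⟨a, Set.mem_iInter₂.2 ha⟩)
    obtain ⟨n, rfl⟩ := he a
    exact Set.mem_iInter₂.1 (ha (n + 1)) n (Finset.self_mem_range_succ n) (heS n)
  obtain ⟨n, hn⟩ := hex
  refine ⟨e '' (Finset.range n : Set ℕ), (Finset.finite_toSet _).image _, fun a => ?_⟩
  obtain ⟨m, hm, ha⟩ := hn a
  obtain ⟨g, hg⟩ := ((hS m).sameType (heS m) ha).exists_aut hcat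
  exact ⟨e m, ⟨m, hm, rfl⟩, g, funext hg⟩

/-- Invariant relations on an `ω`-categorical structure are definable. -/
theorem definable_of_invariant [Countable L.Symbols] (hcat : IsOmegaCategorical L X)
    [Finite ι] {S : Set (ι → X)} (hS : ∀ (g : Aut L X), ∀ a ∈ S, g • a ∈ S) :
    (∅ : Set X).Definable L S := by
  obtain ⟨F, hF, hFS⟩ := exists_finite_orbit_representatives hcat (ι := ι)
  have hiso := fun a : ι → X => IsIsolated.of_isOmegaCategorical hcat a
  choose A hA haA using hiso
  have hfin : (F ∩ S).Finite := hF.inter_of_left S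
  have heq : S = ⋃ b ∈ hfin.toFinset, A b := by
    ext a
    simp only [Set.mem_iUnion, Set.Finite.mem_toFinset, exists_prop]
    constructor
    · intro ha
      obtain ⟨b, hb, g, rfl⟩ := hFS a
      refine ⟨b, ⟨hb, ?_⟩, (sameType_smul g b _ (hA b).1).1 (haA b)⟩
      simpa using hS g⁻¹ _ ha
    · rintro ⟨b, ⟨-, hb⟩, ha⟩
      obtain ⟨g, hg⟩ := ((hA b).sameType (haA b) ha).exists_aut hcat
      have : g • b = a := funext hg
      exact this ▸ hS g b hb
  rw [heq]
  exact Set.definable_biUnion_finset (fun b => (hA b).1) _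

/-- In an `ω`-categorical structure with weak elimination of imaginaries, every open subgroup of
the automorphism group contains the stabiliser of a real tuple with finite index. -/
theorem exists_tuple_of_stabilizer_le [Countable L.Symbols] (hcat : IsOmegaCategorical L X)
    (hwei : WeakEliminationOfImaginaries L X) (V : Subgroup (Aut L X)) {m : ℕ} (a : Fin m → X)
    (ha : ∀ g : Aut L X, g • a = a → g ∈ V) :
    ∃ (n : ℕ) (c : Fin n → X), (∀ g : Aut L X, g • c = c → g ∈ V) ∧
      {d | ∃ g ∈ V, g • c = d}.Finite := by
  -- On the orbit of `a`, `E` compares left cosets of `V`. The class of `a` is `V · a`, and its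
  -- setwise stabiliser is `V` because `V` contains the stabiliser of `a`.
  let E : (Fin m → X) → (Fin m → X) → Prop := fun b b' =>
    ∃ g g' : Aut L X, g • a = b ∧ g' • a = b' ∧ g⁻¹ * g' ∈ V
  have hE : ∀ (g h h' : Aut L X), g • a = h • a → (g⁻¹ * h' ∈ V ↔ h⁻¹ * h' ∈ V) := by
    intro g h h' hgh
    have : h⁻¹ * g ∈ V := ha _ (by rw [mul_smul, hgh, inv_smul_smul])
    constructor
    · intro h1
      have := V.mul_mem this h1
      simpa [mul_assoc] using this
    · intro h1
      have := V.mul_mem (V.inv_mem this) h1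
      simpa [mul_assoc] using this
  let α : Set (Fin m → X) := {b | E a b}
  have hα : ∀ b, b ∈ α ↔ ∃ g ∈ V, g • a = b := by
    intro b
    constructor
    · rintro ⟨g, g', hg, hg', hV⟩
      rw [hE g 1 g' (by simpa using hg)] at hV
      exact ⟨g', by simpa using hV, hg'⟩
    · rintro ⟨g, hg, rfl⟩
      exact ⟨1, g, one_smul _ _, rfl, by simpa using hg⟩
  have himag : IsImaginary L X m α := by
    refine ⟨{b | ∃ g : Aut L X, g • a = b}, E, ?_, ?_, ?_, ?_, ?_, ?_, a, ⟨1, one_smul _ _⟩, rfl⟩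
    · refine definable_of_invariant hcat ?_
      rintro g _ ⟨h, rfl⟩
      exact ⟨g * h, mul_smul _ _ _⟩
    · refine definable_of_invariant hcat ?_
      rintro g b ⟨h, h', hh, hh', hV⟩
      refine ⟨g * h, g * h', ?_, ?_, by simpa [mul_assoc] using hV⟩
      · rw [mul_smul, hh]; rfl
      · rw [mul_smul, hh']; rfl
    · rintro b b' ⟨g, g', hg, hg', -⟩
      exact ⟨⟨g, hg⟩, ⟨g', hg'⟩⟩
    · rintro b ⟨g, hg⟩
      exact ⟨g, g, hg, hg, by simp⟩
    · rintro b b' ⟨g, g', hg, hg', hV⟩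
      exact ⟨g', g, hg', hg, by simpa using V.inv_mem hV⟩
    · rintro b b' b'' ⟨g, g', hg, hg', hV⟩ ⟨h, h', hh, hh', hV'⟩
      refine ⟨g, h', hg, hh', ?_⟩
      rw [hE h g' h' (hh.trans hg'.symm)] at hV'
      simpa [mul_assoc] using V.mul_mem hV hV'
  obtain ⟨n, φ, hfin, c, hc⟩ := hwei m α himag
  have hαφ : ∀ b, b ∈ α ↔ φ.Realize (Sum.elim b c) := fun b => by
    have h : α = {b | φ.Realize (Sum.elim b c)} := hc
    rw [h]; rfl
  have hφ : ∀ (g : Aut L X) b, φ.Realize (Sum.elim (g • b) (g • c)) ↔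
      φ.Realize (Sum.elim b c) := by
    intro g b
    rw [← realize_comp_equiv_iff (g : X ≃[L] X) φ (Sum.elim b c)]
    rw [iff_iff_eq]
    congr 1
    funext i
    rcases i with i | i <;> rfl
  have hVα : ∀ g ∈ V, ∀ b, g • b ∈ α ↔ b ∈ α := by
    intro g hg b
    simp only [hα]
    constructor
    · rintro ⟨h, hh, hhb⟩
      exact ⟨g⁻¹ * h, V.mul_mem (V.inv_mem hg) hh, by rw [mul_smul, hhb, inv_smul_smul]⟩
    · rintro ⟨h, hh, rfl⟩
      exact ⟨g * h, V.mul_mem hg hh, mul_smul _ _ _⟩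
  refine ⟨n, c, fun g hg => ?_, hfin.subset ?_⟩
  · have h1 : g • a ∈ α := by
      rw [hαφ]
      nth_rw 1 [← hg]
      rw [hφ, ← hαφ, hα]
      exact ⟨1, V.one_mem, one_smul _ _⟩
    obtain ⟨h, hh, hha⟩ := (hα _).1 h1
    have h2 : h⁻¹ * g ∈ V := ha _ (by rw [mul_smul, ← hha, inv_smul_smul])
    simpa using V.mul_mem hh h2
  -- `V` preserves `α`, so it permutes the finitely many tuples that define `α` through `φ`.
  · rintro _ ⟨g, hg, rfl⟩
    change α = {b | φ.Realize (Sum.elim b (g • c))}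
    ext b
    change b ∈ α ↔ φ.Realize (Sum.elim b (g • c))
    rw [← hVα g⁻¹ (V.inv_mem hg), hαφ, ← hφ g, smul_inv_smul]

end Orbits

/-! ### Weak closures and weak accumulation points in Hilbert space. -/

section WeakClosure

variable {H : Type*} [NormedAddCommGroup H] [InnerProductSpace ℂ H]

/-- The closure of a set of vectors in the weak topology. -/
def weakClosure (S : Set H) : Set H :=
  {u | (fun η => inner ℂ η u) ∈ closure ((fun v η => inner ℂ η v : H → H → ℂ) '' S)}

theorem subset_weakClosure (S : Set H) : S ⊆ weakClosure S := fun u hu =>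
  subset_closure ⟨u, hu, rfl⟩

theorem weakClosure_subset {S T : Set H} (h : S ⊆ weakClosure T) :
    weakClosure S ⊆ weakClosure T := fun _ hu =>
  closure_minimal (by rintro _ ⟨v, hv, rfl⟩; exact h hv) isClosed_closure hu

theorem inner_mem_of_mem_weakClosure {S : Set H} {u : H} (hu : u ∈ weakClosure S) (η : H)
    {C : Set ℂ} (hC : IsClosed C) (h : ∀ v ∈ S, inner ℂ η v ∈ C) : inner ℂ η u ∈ C := by
  have h1 : IsClosed {F : H → ℂ | F η ∈ C} := hC.preimage (continuous_apply η)
  exact closure_minimal (t := {F : H → ℂ | F η ∈ C}) (by rintro _ ⟨v, hv, rfl⟩; exact h v hv) h1 hu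

/-- Testing `u` against itself gives `‖u‖² ≤ ‖u‖ r`. When `u = 0`, nonemptiness of `S` supplies `0 ≤
r`. -/
theorem norm_le_of_mem_weakClosure {S : Set H} {u : H} (hu : u ∈ weakClosure S) {r : ℝ}
    (h : ∀ v ∈ S, ‖v‖ ≤ r) : ‖u‖ ≤ r := by
  have h1 := inner_mem_of_mem_weakClosure hu u (C := Metric.closedBall 0 (‖u‖ * r))
    Metric.isClosed_closedBall fun v hv => by
      rw [mem_closedBall_zero_iff]
      exact (norm_inner_le_norm u v).trans (by gcongr; exact h v hv)
  rw [mem_closedBall_zero_iff, inner_self_eq_norm_sq_to_K] at h1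
  have h2 : ‖u‖ * ‖u‖ ≤ ‖u‖ * r := by
    simpa [sq] using h1
  rcases (norm_nonneg u).eq_or_lt with h0 | h0
  · have hne : S.Nonempty := by
      by_contra hS
      rw [Set.not_nonempty_iff_eq_empty] at hS
      rw [hS] at hu
      simp [weakClosure] at hu
    rw [← h0]
    exact (norm_nonneg _).trans (h _ hne.some_mem)
  · exact le_of_mul_le_mul_left h2 h0

theorem map_mem_weakClosure {S T : Set H} {u : H} (hu : u ∈ weakClosure S) (f : H ≃ₗᵢ[ℂ] H)
    (h : ∀ v ∈ S, f v ∈ weakClosure T) : f u ∈ weakClosure T := by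
  have hf : ∀ v, (fun η => inner ℂ η (f v)) =
      (fun (F : H → ℂ) η => F (f.symm η)) (fun η => inner ℂ η v) := by
    intro v
    funext η
    have := f.inner_map_map (f.symm η) v
    rwa [f.apply_symm_apply] at this
  have hcont : Continuous fun (F : H → ℂ) (η : H) => F (f.symm η) :=
    continuous_pi fun η => continuous_apply _
  change _ ∈ closure _
  rw [hf, ← closure_closure]
  refine map_mem_closure hcont hu ?_
  rintro _ ⟨v, hv, rfl⟩
  rw [← hf]
  exact h v hv

/-- A bounded infinite set of vectors of a Hilbert space has a weak accumulation point. -/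
theorem exists_mem_weakClosure_sdiff [CompleteSpace H] {M : Set H} (hM : M.Infinite) {r : ℝ}
    (hr : ∀ v ∈ M, ‖v‖ ≤ r) : ∃ u, u ∈ weakClosure (M \ {u}) := by
  let j : H → H → ℂ := fun v η => inner ℂ η v
  have hj : Function.Injective j := fun v w hvw =>
    ext_inner_left ℂ fun η => congrFun hvw η
  let K : Set (H → ℂ) := Set.univ.pi fun η => Metric.closedBall (0 : ℂ) (‖η‖ * r)
  have hK : IsCompact K := isCompact_univ_pi fun η => isCompact_closedBall _ _
  have hMK : j '' M ⊆ K := by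
    rintro _ ⟨v, hv, rfl⟩ η -
    rw [mem_closedBall_zero_iff]
    exact (norm_inner_le_norm η v).trans (by gcongr; exact hr v hv)
  -- An accumulation point in the compact product of discs is still conjugate-linear and bounded, so
  -- the Riesz theorem represents it by a vector.
  obtain ⟨F, hFK, hF⟩ := (hM.image hj.injOn).exists_accPt_of_subset_isCompact hK hMK
  rw [accPt_principal_iff_clusterPt, ← mem_closure_iff_clusterPt] at hF
  have hFM : F ∈ closure (j '' M) := closure_mono Set.sdiff_subset hF
  have hadd : ∀ η η', F (η + η') = F η + F η' := by
    intro η η'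
    refine closure_minimal (t := {F : H → ℂ | F (η + η') = F η + F η'}) ?_
      (isClosed_eq (by fun_prop) (by fun_prop)) hFM
    rintro _ ⟨v, -, rfl⟩
    exact inner_add_left _ _ _
  have hsmul : ∀ (c : ℂ) η, F (c • η) = (starRingEnd ℂ) c * F η := by
    intro c η
    refine closure_minimal (t := {F : H → ℂ | F (c • η) = (starRingEnd ℂ) c * F η}) ?_
      (isClosed_eq (by fun_prop) (by fun_prop)) hFM
    rintro _ ⟨v, -, rfl⟩
    exact inner_smul_left _ _ _
  let l : H →L[ℂ] ℂ := LinearMap.mkContinuous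
    { toFun := fun η => (starRingEnd ℂ) (F η)
      map_add' := fun η η' => by rw [hadd, map_add]
      map_smul' := fun c η => by simp [hsmul] } r (fun η => by
        have := hFK η trivial
        rw [mem_closedBall_zero_iff, mul_comm] at this
        simpa using this)
  let u := (InnerProductSpace.toDual ℂ H).symm l
  have hu : j u = F := by
    funext η
    have h1 : inner ℂ u η = l η := InnerProductSpace.toDual_symm_apply
    change inner ℂ η u = F η
    rw [← inner_conj_symm, h1]
    exact Complex.conj_conj _
  have hF' : j u ∈ closure (j '' M \ {j u}) := by rw [hu]; exact hF
  refine ⟨u, closure_mono ?_ hF'⟩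
  rintro _ ⟨⟨v, hv, rfl⟩, hne⟩
  exact ⟨v, ⟨hv, fun h => hne (congrArg j (Set.mem_singleton_iff.1 h))⟩, rfl⟩

end WeakClosure

/-! ### Algebraic closure in oligomorphic permutation groups. -/

section PermutationGroups

open MulAction

variable {G : Type*} [Group G] {X : Type*} [MulAction G X]

variable (G X) in
/-- Finitely many orbits on finite tuples. -/
def IsOligomorphic : Prop :=
  ∀ n : ℕ, ∃ F : Set (Fin n → X), F.Finite ∧ ∀ a, ∃ b ∈ F, ∃ g : G, g • b = a

variable (G X) in
/-- Every open subgroup has the pointwise stabiliser of some finite set as a subgroup of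
finite index. -/
def HasFiniteIndexFixers : Prop :=
  ∀ (V : Subgroup G) (A : Set X), A.Finite → fixingSubgroup G A ≤ V →
    ∃ C : Set X, C.Finite ∧ fixingSubgroup G C ≤ V ∧ ∀ x ∈ C, (orbit V x).Finite

variable (G) in
/-- A finite set that contains every point with a finite orbit under its pointwise stabiliser. -/
def IsAclClosed (A : Set X) : Prop :=
  A.Finite ∧ ∀ x, (orbit (fixingSubgroup G A) x).Finite → x ∈ A

theorem orbit_mono {V W : Subgroup G} (h : V ≤ W) (x : X) : orbit V x ⊆ orbit W x := by
  rintro _ ⟨g, rfl⟩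
  exact ⟨⟨g, h g.2⟩, rfl⟩

theorem fixingSubgroup_anti {A B : Set X} (h : A ⊆ B) :
    fixingSubgroup G B ≤ fixingSubgroup G A := fun g hg => by
  rw [mem_fixingSubgroup_iff] at hg ⊢
  exact fun x hx => hg x (h hx)

/-- Within `W`, each fibre of `F` lies in one left coset of `V`. Finitely many such cosets cover
`W`, so the `W`-orbit of `x` is covered by finitely many translates of its `V`-orbit. -/
theorem finite_orbit_of_finite_index {V W : Subgroup G} {Y : Type*} (F : G → Y)
    (hfin : (F '' W).Finite) (hF : ∀ g ∈ W, ∀ h ∈ W, F g = F h → g⁻¹ * h ∈ V) {x : X}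
    (hx : (orbit V x).Finite) : (orbit W x).Finite := by
  have hr : ∀ y : Y, ∃ g : G, y ∈ F '' W → g ∈ W ∧ F g = y := fun y => by
    by_cases h : y ∈ F '' W
    · obtain ⟨g, hg, hgy⟩ := h
      exact ⟨g, fun _ => ⟨hg, hgy⟩⟩
    · exact ⟨1, fun h' => absurd h' h⟩
  choose r hr using hr
  refine (hfin.biUnion fun y _ => hx.image (r y • ·)).subset ?_
  rintro _ ⟨⟨g, hg⟩, rfl⟩
  have hy : F g ∈ F '' W := ⟨g, hg, rfl⟩
  have := hF _ (hr _ hy).1 g hg (hr _ hy).2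
  refine Set.mem_biUnion hy ⟨_, ⟨⟨_, this⟩, rfl⟩, ?_⟩
  change r (F g) • (((r (F g))⁻¹ * g) • x) = g • x
  rw [mul_smul, smul_inv_smul]

theorem exists_tuple_of_finite {A : Set X} (hA : A.Finite) :
    ∃ (n : ℕ) (a : Fin n → X), Set.range a = A := by
  obtain ⟨n, f, hf⟩ := hA.fin_embedding
  exact ⟨n, f, hf⟩

theorem mem_fixingSubgroup_range_iff {n : ℕ} {a : Fin n → X} {g : G} :
    g ∈ fixingSubgroup G (Set.range a) ↔ g • a = a := by
  rw [mem_fixingSubgroup_iff, Set.forall_mem_range, funext_iff]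
  rfl

/-- Take all points with finite orbit under the stabiliser of a tuple `a` enumerating `A`. Two
points `x`, `y` with `(a, x)` and `(a, y)` conjugate share such an orbit, so oligomorphy leaves
finitely many finite orbits. Passing to the stabiliser of `B` costs only finite index, so no new
algebraic points arise. -/
theorem IsOligomorphic.exists_isAclClosed (h : IsOligomorphic G X) {A : Set X} (hA : A.Finite) :
    ∃ B, A ⊆ B ∧ IsAclClosed G B := by
  let B : Set X := {x | (orbit (fixingSubgroup G A) x).Finite}
  have hAB : A ⊆ B := fun x hx => by
    refine (Set.finite_singleton x).subset ?_
    rintro _ ⟨⟨g, hg⟩, rfl⟩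
    exact (mem_fixingSubgroup_iff G).1 hg x hx
  have hB : B.Finite := by
    obtain ⟨n, a, rfl⟩ := exists_tuple_of_finite hA
    obtain ⟨F, hF, hFX⟩ := h (n + 1)
    refine (hF.biUnion (t := fun b => {x | x ∈ B ∧ ∃ g : G, g • b = Fin.snoc (α := fun _ => X) a x})
      fun b _ => ?_).subset fun x hx => ?_
    · rcases Set.eq_empty_or_nonempty
        {x | x ∈ B ∧ ∃ g : G, g • b = Fin.snoc (α := fun _ => X) a x} with he | ⟨x, hx, g, hg⟩
      · rw [he]; exact Set.finite_empty
      · refine Set.Finite.subset hx ?_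
        rintro y ⟨-, k, hk⟩
        have h1 : (k * g⁻¹) • Fin.snoc (α := fun _ => X) a x = Fin.snoc (α := fun _ => X) a y := by
          rw [← hg, ← hk, mul_smul, inv_smul_smul]
        refine ⟨⟨k * g⁻¹, mem_fixingSubgroup_range_iff.2 ?_⟩, ?_⟩
        · funext i
          simpa using congrFun h1 i.castSucc
        · simpa using congrFun h1 (Fin.last n)
    · obtain ⟨b, hb, g, hg⟩ := hFX (Fin.snoc (α := fun _ => X) a x)
      exact Set.mem_biUnion hb ⟨hx, g, hg⟩
  refine ⟨B, hAB, hB, fun x hx => ?_⟩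
  have := hB.to_subtype
  refine finite_orbit_of_finite_index (V := fixingSubgroup G B)
    (fun (g : G) (y : B) => g • (y : X)) ?_ ?_ hx
  · refine (Set.Finite.pi' (t := fun y : B => orbit (fixingSubgroup G A) (y : X))
      fun y => y.2).subset ?_
    rintro _ ⟨g, hg, rfl⟩ y
    exact ⟨⟨g, hg⟩, rfl⟩
  · intro g _ k _ hgk
    rw [mem_fixingSubgroup_iff]
    intro y hy
    rw [mul_smul, inv_smul_eq_iff]
    exact (congrFun hgk ⟨y, hy⟩).symm

theorem IsAclClosed.smul {A : Set X} (hA : IsAclClosed G A) (g : G) :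
    IsAclClosed G ((g • ·) '' A) := by
  refine ⟨hA.1.image _, fun x hx => ⟨g⁻¹ • x, hA.2 _ ?_, smul_inv_smul _ _⟩⟩
  refine (hx.image (g⁻¹ • ·)).subset ?_
  rintro _ ⟨⟨k, hk⟩, rfl⟩
  refine ⟨(g * k * g⁻¹) • x, ⟨⟨g * k * g⁻¹, ?_⟩, rfl⟩, ?_⟩
  · rw [mem_fixingSubgroup_iff] at hk ⊢
    rintro _ ⟨y, hy, rfl⟩
    simp only [mul_smul, inv_smul_smul]
    rw [hk y hy]
  · change g⁻¹ • (g * k * g⁻¹) • x = k • g⁻¹ • x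
    simp [mul_smul]

theorem IsAclClosed.inter {A B : Set X} (hA : IsAclClosed G A) (hB : IsAclClosed G B) :
    IsAclClosed G (A ∩ B) :=
  ⟨hA.1.inter_of_left B, fun x hx =>
    ⟨hA.2 x (hx.subset (orbit_mono (fixingSubgroup_anti Set.inter_subset_left) x)),
      hB.2 x (hx.subset (orbit_mono (fixingSubgroup_anti Set.inter_subset_right) x))⟩⟩

end PermutationGroups

/-! ### Vectors fixed by open subgroups and the projections onto them. -/

section Invariants

open MulAction

variable {G : Type*} [Group G] {X : Type*} [MulAction G X]
variable {H : Type*} [NormedAddCommGroup H] [InnerProductSpace ℂ H]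
variable (π : G →* (H ≃ₗᵢ[ℂ] H))

theorem rep_mul (g h : G) (ξ : H) : π (g * h) ξ = π g (π h ξ) := by
  rw [map_mul]; rfl

theorem rep_one (ξ : H) : π 1 ξ = ξ := by
  rw [map_one]; rfl

theorem rep_inv_self (g : G) (ξ : H) : π g⁻¹ (π g ξ) = ξ := by
  rw [← rep_mul, inv_mul_cancel, rep_one]

theorem inner_rep_left (g : G) (ξ η : H) : inner ℂ (π g ξ) η = inner ℂ ξ (π g⁻¹ η) := by
  rw [← (π g⁻¹).inner_map_map, rep_inv_self]

/-- The vectors fixed by a subgroup. -/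
def invariants (V : Subgroup G) : Submodule ℂ H where
  carrier := {ξ | ∀ g ∈ V, π g ξ = ξ}
  zero_mem' := fun g _ => map_zero _
  add_mem' := fun {ξ η} hξ hη g hg => by rw [map_add, hξ g hg, hη g hg]
  smul_mem' := fun c ξ hξ g hg => by rw [map_smul, hξ g hg]

theorem mem_invariants {V : Subgroup G} {ξ : H} :
    ξ ∈ invariants π V ↔ ∀ g ∈ V, π g ξ = ξ := Iff.rfl

theorem invariants_anti {V W : Subgroup G} (h : V ≤ W) : invariants π W ≤ invariants π V :=
  fun _ hξ g hg => hξ g (h hg)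

theorem isClosed_invariants (V : Subgroup G) : IsClosed (invariants π V : Set H) := by
  have : (invariants π V : Set H) = ⋂ g ∈ V, {ξ | π g ξ = ξ} := by
    ext ξ
    simp [mem_invariants]
  rw [this]
  exact isClosed_biInter fun g _ => isClosed_eq (π g).continuous continuous_id

instance [CompleteSpace H] (V : Subgroup G) : CompleteSpace (invariants π V) :=
  (isClosed_invariants π V).completeSpace_coe

/-- The stabiliser of a vector. -/
def vectorStabilizer (ξ : H) : Subgroup G where
  carrier := {g | π g ξ = ξ}
  one_mem' := rep_one π ξ
  mul_mem' := fun {g h} hg hh => by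
    change π (g * h) ξ = ξ
    rw [rep_mul, show π h ξ = ξ from hh, show π g ξ = ξ from hg]
  inv_mem' := fun {g} hg => by
    change π g⁻¹ ξ = ξ
    nth_rw 1 [← show π g ξ = ξ from hg]
    exact rep_inv_self π g ξ

/-- The orbit of a vector under a subgroup. -/
def vectorOrbit (V : Subgroup G) (ξ : H) : Set H := (fun g => π g ξ) '' V

theorem mem_vectorOrbit_self (V : Subgroup G) (ξ : H) : ξ ∈ vectorOrbit π V ξ :=
  ⟨1, V.one_mem, rep_one π ξ⟩

theorem rep_mem_weakClosure {V : Subgroup G} {ξ u : H} (hu : u ∈ weakClosure (vectorOrbit π V ξ))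
    {g : G} (hg : g ∈ V) : π g u ∈ weakClosure (vectorOrbit π V ξ) := by
  refine map_mem_weakClosure hu (π g) ?_
  rintro _ ⟨h, hh, rfl⟩
  refine subset_weakClosure _ ⟨g * h, V.mul_mem hg hh, rep_mul π g h ξ⟩

/-- Pairing with a `V`-fixed vector is constant on the `V`-orbit of `ξ`, hence also on its weak
closure. -/
theorem starProjection_eq_of_mem_weakClosure [CompleteSpace H] {V : Subgroup G} {ξ u : H}
    (hu : u ∈ weakClosure (vectorOrbit π V ξ)) (huV : u ∈ invariants π V) :
    (invariants π V).starProjection ξ = u := by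
  refine Submodule.eq_starProjection_of_mem_of_inner_eq_zero huV fun η hη => ?_
  rw [← inner_conj_symm, map_eq_zero, inner_sub_right, sub_eq_zero]
  symm
  refine inner_mem_of_mem_weakClosure hu η (C := {inner ℂ η ξ}) isClosed_singleton ?_
  rintro _ ⟨g, hg, rfl⟩
  have : inner ℂ (π g η) (π g ξ) = inner ℂ η ξ := (π g).inner_map_map _ _
  rwa [hη g hg] at this

variable (X) in
/-- Strong continuity at the identity, for the topology in which the pointwise stabilisers of
finite subsets of `X` form a basis of neighbourhoods of the identity. -/
def IsFixerContinuous : Prop :=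
  ∀ (ξ : H) (ε : ℝ), 0 < ε → ∃ A : Set X, A.Finite ∧ ∀ g ∈ fixingSubgroup G A, ‖π g ξ - ξ‖ < ε

variable {π}

/-- A vector fixed by a finite-index subgroup of the pointwise stabiliser of an algebraically
closed set is fixed by this stabiliser. -/
theorem mem_invariants_of_finite_vectorOrbit (hX : HasFiniteIndexFixers G X)
    (hπ : IsFixerContinuous X π) {A : Set X} (hA : IsAclClosed G A) {u : H}
    (hu : (vectorOrbit π (fixingSubgroup G A) u).Finite) :
    u ∈ invariants π (fixingSubgroup G A) := by
  -- A finite orbit is discrete, so the elements of the fixer that move `u` by less than some `δ`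
  -- fix it; this makes the stabiliser of `u` open.
  have hnhds : (vectorOrbit π (fixingSubgroup G A) u \ {u})ᶜ ∈ nhds u :=
    (hu.subset Set.sdiff_subset).isClosed.isOpen_compl.mem_nhds fun h => h.2 rfl
  obtain ⟨δ, hδ, hball⟩ := Metric.mem_nhds_iff.1 hnhds
  obtain ⟨B, hB, hBu⟩ := hπ u δ hδ
  obtain ⟨C, -, hCV, hCx⟩ := hX (fixingSubgroup G A ⊓ vectorStabilizer π u) (A ∪ B)
    (hA.1.union hB) (fun g hg => by
      have hgA := fixingSubgroup_anti Set.subset_union_left hg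
      refine ⟨hgA, ?_⟩
      have h1 := hball (show π g u ∈ Metric.ball u δ by
        rw [mem_ball_iff_norm]
        exact hBu g (fixingSubgroup_anti Set.subset_union_right hg))
      by_contra hne
      exact h1 ⟨⟨g, hgA, rfl⟩, hne⟩)
  -- The stabiliser of `u` has finite index in the fixer of `A`, so the points of `C` are algebraic
  -- over `A`.
  have hCA : C ⊆ A := fun x hx => by
    refine hA.2 x (finite_orbit_of_finite_index (fun g => π g u) hu ?_ (hCx x hx))
    intro g hg h hh hgh
    refine ⟨Subgroup.mul_mem _ (Subgroup.inv_mem _ hg) hh, ?_⟩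
    change π (g⁻¹ * h) u = u
    rw [rep_mul, ← show π g u = π h u from hgh, rep_inv_self]
  exact fun g hg => (hCV (fixingSubgroup_anti hCA hg)).2

/-- On the orbit itself the inner products are matrix coefficients. The inner product is not jointly
weakly continuous, so the limits are taken one variable at a time, and the finite set `S` is closed.
-/
theorem inner_mem_of_mem_weakClosure_vectorOrbit {ξ : H} {S : Set ℂ} (hS : S.Finite)
    (hξ : ∀ g, inner ℂ (π g ξ) ξ ∈ S) {u v : H} (hu : u ∈ weakClosure (vectorOrbit π ⊤ ξ))
    (hv : v ∈ weakClosure (vectorOrbit π ⊤ ξ)) : inner ℂ u v ∈ S := by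
  have h1 : ∀ h, inner ℂ (π h ξ) v ∈ S := fun h => by
    refine inner_mem_of_mem_weakClosure hv _ hS.isClosed ?_
    rintro _ ⟨g, -, rfl⟩
    have : inner ℂ (π h ξ) (π g ξ) = inner ℂ (π (g⁻¹ * h) ξ) ξ := by
      rw [rep_mul, inner_rep_left _ g⁻¹, inv_inv]
    exact this ▸ hξ _
  have h2 := inner_mem_of_mem_weakClosure hu v (hS.image (starRingEnd ℂ)).isClosed (by
    rintro _ ⟨g, -, rfl⟩
    exact ⟨_, h1 g, inner_conj_symm _ _⟩)
  obtain ⟨z, hz, hzv⟩ := h2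
  rw [← inner_conj_symm, ← hzv, Complex.conj_conj]
  exact hz

/-- The weak closure of the orbit of a vector with finitely many matrix coefficients is stable
under the projections onto the vectors fixed by stabilisers of algebraically closed sets. -/
theorem starProjection_mem_weakClosure [CompleteSpace H] (hX : HasFiniteIndexFixers G X)
    (hπ : IsFixerContinuous X π) {ξ : H} (hξ : (Set.range fun g => inner ℂ (π g ξ) ξ).Finite)
    {A : Set X} (hA : IsAclClosed G A) {u : H} (hu : u ∈ weakClosure (vectorOrbit π ⊤ ξ)) :
    (invariants π (fixingSubgroup G A)).starProjection u ∈ weakClosure (vectorOrbit π ⊤ ξ) := by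
  set V := fixingSubgroup G A
  set W := weakClosure (vectorOrbit π V u)
  have hW : W ⊆ weakClosure (vectorOrbit π ⊤ ξ) := weakClosure_subset (by
    rintro _ ⟨g, -, rfl⟩
    exact rep_mem_weakClosure π hu trivial)
  have hinner : ∀ v ∈ W, ∀ w ∈ W, inner ℂ v w ∈ Set.range fun g => inner ℂ (π g ξ) ξ :=
    fun v hv w hw => inner_mem_of_mem_weakClosure_vectorOrbit hξ (fun g => ⟨g, rfl⟩) (hW hv) (hW hw)
  have hnorm : ((fun v : H => ‖v‖) '' W).Finite := by
    refine (hξ.image fun z : ℂ => Real.sqrt z.re).subset ?_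
    rintro _ ⟨v, hv, rfl⟩
    refine ⟨_, hinner v hv v hv, ?_⟩
    exact (norm_eq_sqrt_re_inner (𝕜 := ℂ) v).symm
  obtain ⟨_, ⟨u₀, hu₀, rfl⟩, hmin⟩ := Set.exists_min_image _ id hnorm
    ⟨_, u, subset_weakClosure _ (mem_vectorOrbit_self π V u), rfl⟩
  let M := {v ∈ W | ‖v‖ = ‖u₀‖}
  -- A weak accumulation point `m` of `M` would again lie in `M`. As `⟨m, v⟩` takes finitely many
  -- values, some `v ≠ m` in `M` has `⟨m, v⟩ = ‖m‖²`; with equal norms this forces `v = m`.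
  have hM : M.Finite := by
    by_contra hinf
    obtain ⟨m, hm⟩ := exists_mem_weakClosure_sdiff (M := M) hinf (fun v hv => hv.2.le)
    have hmW : m ∈ W := weakClosure_subset (fun v hv => hv.1.1) hm
    have hmn : ‖m‖ = ‖u₀‖ := le_antisymm
      (norm_le_of_mem_weakClosure hm fun v hv => hv.1.2.le) (hmin _ ⟨m, hmW, rfl⟩)
    have hex : inner ℂ m m ∈ (fun v => inner ℂ m v) '' (M \ {m}) := by
      refine inner_mem_of_mem_weakClosure hm m (Set.Finite.isClosed ?_) fun v hv => ⟨v, hv, rfl⟩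
      refine hξ.subset ?_
      rintro _ ⟨v, hv, rfl⟩
      exact hinner m hmW v hv.1.1
    obtain ⟨v, ⟨⟨hvW, hvn⟩, hvm⟩, hmv⟩ := hex
    refine hvm ?_
    have h1 : ‖m - v‖ ^ 2 = 0 := by
      rw [norm_sub_sq (𝕜 := ℂ), show inner ℂ m v = inner ℂ m m from hmv, inner_self_eq_norm_sq,
        hvn, hmn]
      ring
    have h2 : m - v = 0 := by simpa using h1
    exact (sub_eq_zero.1 h2).symm
  have hu₀V : u₀ ∈ invariants π V := by
    refine mem_invariants_of_finite_vectorOrbit hX hπ hA (hM.subset ?_)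
    rintro _ ⟨g, hg, rfl⟩
    exact ⟨rep_mem_weakClosure π hu₀ hg, (π g).norm_map _⟩
  rw [starProjection_eq_of_mem_weakClosure π hu₀ hu₀V]
  exact hW hu₀

/-- If `P` and `Q` are orthogonal projections and `Q P Q` kills a vector of the range of `P`,
so does `Q`. -/
theorem starProjection_eq_zero_of_comp {K M : Submodule ℂ H} [K.HasOrthogonalProjection]
    [M.HasOrthogonalProjection] {ρ : H} (hρ : ρ ∈ K)
    (h : M.starProjection (K.starProjection (M.starProjection ρ)) = 0) :
    M.starProjection ρ = 0 := by
  have h1 : K.starProjection (M.starProjection ρ) = 0 := by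
    rw [← inner_self_eq_zero (𝕜 := ℂ), Submodule.inner_starProjection_left_eq_right,
      Submodule.starProjection_eq_self_iff.2 (Submodule.starProjection_apply_mem _ _),
      Submodule.inner_starProjection_left_eq_right, h, inner_zero_right]
  rw [← inner_self_eq_zero (𝕜 := ℂ), Submodule.inner_starProjection_left_eq_right,
    Submodule.starProjection_eq_self_iff.2 (Submodule.starProjection_apply_mem _ _),
    ← Submodule.starProjection_eq_self_iff.2 hρ, Submodule.inner_starProjection_left_eq_right,
    Submodule.starProjection_eq_self_iff.2 hρ, h1, inner_zero_right]

theorem starProjection_eq_self_of_norm_eq {K : Submodule ℂ H} [K.HasOrthogonalProjection] {ρ : H}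
    (h : ‖ρ‖ ≤ ‖K.starProjection ρ‖) : K.starProjection ρ = ρ := by
  have h1 : ‖ρ - K.starProjection ρ‖ ^ 2 ≤ 0 := by
    have h2 : RCLike.re (inner ℂ ρ (K.starProjection ρ)) = ‖K.starProjection ρ‖ ^ 2 := by
      rw [← inner_self_eq_norm_sq (𝕜 := ℂ), Submodule.inner_starProjection_left_eq_right,
        Submodule.starProjection_eq_self_iff.2 (Submodule.starProjection_apply_mem _ _)]
    rw [norm_sub_sq (𝕜 := ℂ), h2]
    nlinarith [norm_nonneg ρ]
  have h3 : ‖ρ - K.starProjection ρ‖ = 0 := by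
    nlinarith [norm_nonneg (ρ - K.starProjection ρ), sq_nonneg (‖ρ - K.starProjection ρ‖)]
  exact (sub_eq_zero.1 (norm_eq_zero.1 h3)).symm

/-- If the norms of the vectors `(P_K P_M)^k ξ` take finitely many values, then `P_M ξ` lies
in `K ⊓ M`. -/
theorem starProjection_mem_of_finite_norms {K M : Submodule ℂ H} [K.HasOrthogonalProjection]
    [M.HasOrthogonalProjection] {Ξ : Set H} (hΞ : ((fun v : H => ‖v‖) '' Ξ).Finite)
    (hK : ∀ v ∈ Ξ, K.starProjection v ∈ Ξ) (hM : ∀ v ∈ Ξ, M.starProjection v ∈ Ξ)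
    {ξ : H} (hξ : ξ ∈ Ξ) (hξK : ξ ∈ K) : M.starProjection ξ ∈ K := by
  suffices h : ∀ r ∈ (fun v : H => ‖v‖) '' Ξ, ∀ v ∈ Ξ, v ∈ K → ‖v‖ = r → M.starProjection v ∈ K from
    h _ ⟨ξ, hξ, rfl⟩ ξ hξ hξK rfl
  intro r hr
  refine (hΞ.wellFoundedOn (r := (· < ·))).induction hr
    (P := fun r => ∀ v ∈ Ξ, v ∈ K → ‖v‖ = r → M.starProjection v ∈ K) fun r _ ih v hv hvK hvr => ?_
  set w := K.starProjection (M.starProjection v) with hw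
  have hwΞ : w ∈ Ξ := hK _ (hM v hv)
  have hwK : w ∈ K := Submodule.starProjection_apply_mem _ _
  have h1 : ‖w‖ ≤ ‖M.starProjection v‖ := Submodule.norm_starProjection_apply_le _ _
  have h2 : ‖M.starProjection v‖ ≤ ‖v‖ := Submodule.norm_starProjection_apply_le _ _
  -- Either `P_K P_M v` is shorter than `v` and the induction hypothesis applies to it, or `P_M`
  -- preserves the norm of `v` and hence fixes `v`.
  rcases (h1.trans h2).lt_or_eq with hlt | heq
  · have h3 : M.starProjection w ∈ K := ih _ ⟨w, hwΞ, rfl⟩ (hvr ▸ hlt) w hwΞ hwK rfl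
    set ζ := M.starProjection w with hζ
    have hζM : M.starProjection ζ = ζ :=
      Submodule.starProjection_eq_self_iff.2 (Submodule.starProjection_apply_mem _ _)
    have hζK : K.starProjection ζ = ζ := Submodule.starProjection_eq_self_iff.2 h3
    -- Both projections fix `ζ = P_M P_K P_M v`, so `P_M P_K P_M` kills `v - ζ`, which lies in `K`.
    have h4 : M.starProjection (v - ζ) = 0 := by
      refine starProjection_eq_zero_of_comp (K := K) (K.sub_mem hvK h3) ?_
      rw [map_sub, map_sub, map_sub, hζM, hζK, hζM, ← hw, ← hζ, sub_self]
    rw [map_sub, hζM, sub_eq_zero] at h4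
    rw [h4]
    exact h3
  · have h3 : M.starProjection v = v := starProjection_eq_self_of_norm_eq (by rw [← heq]; exact h1)
    rw [h3]
    exact hvK

end Invariants

/-! ### Orthogonal decomposition indexed by algebraically closed sets. -/

section Decomposition

open MulAction
open scoped Pointwise

variable {G : Type*} [Group G] {X : Type*} [MulAction G X]
variable {H : Type*} [NormedAddCommGroup H] [InnerProductSpace ℂ H]
variable {π : G →* (H ≃ₗᵢ[ℂ] H)}

/-- A vector fixed by the pointwise stabiliser of a finite set has finitely many matrix
coefficients. -/
theorem finite_range_inner_rep (hG : IsOligomorphic G X) {A : Set X} (hA : A.Finite) {ξ : H}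
    (hξ : ξ ∈ invariants π (fixingSubgroup G A)) :
    (Set.range fun g => inner ℂ (π g ξ) ξ).Finite := by
  obtain ⟨n, a, rfl⟩ := exists_tuple_of_finite hA
  obtain ⟨F, hF, hFX⟩ := hG (n + n)
  refine (hF.biUnion (t := fun b => (fun g => inner ℂ (π g ξ) ξ) ''
    {g : G | ∃ k : G, k • b = Fin.append a (g • a)}) fun b _ => ?_).subset ?_
  · refine Set.Subsingleton.finite ?_
    rintro _ ⟨g, ⟨k, hk⟩, rfl⟩ _ ⟨h, ⟨k', hk'⟩, rfl⟩
    have h1 : (k' * k⁻¹) • Fin.append a (g • a) = Fin.append a (h • a) := by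
      rw [← hk, ← hk', mul_smul, inv_smul_smul]
    -- `l` fixes `a` and carries `g • a` to `h • a`, so both `l` and `h⁻¹ l g` fix `ξ`.
    set l := k' * k⁻¹
    have hl : l ∈ fixingSubgroup G (Set.range a) := mem_fixingSubgroup_range_iff.2 <| by
      funext i
      simpa using congrFun h1 (Fin.castAdd n i)
    have hlg : h⁻¹ * (l * g) ∈ fixingSubgroup G (Set.range a) :=
      mem_fixingSubgroup_range_iff.2 <| by
        rw [mul_smul, inv_smul_eq_iff, mul_smul]
        funext i
        have h2 := congrFun h1 (Fin.natAdd n i)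
        simpa only [Pi.smul_apply, Fin.append_right] using h2
    calc inner ℂ (π g ξ) ξ = inner ℂ (π l (π g ξ)) (π l ξ) := ((π l).inner_map_map _ _).symm
      _ = inner ℂ (π (h * (h⁻¹ * (l * g))) ξ) ξ := by
          rw [hξ l hl, mul_inv_cancel_left, rep_mul π l g]
      _ = inner ℂ (π h ξ) ξ := by rw [rep_mul, hξ _ hlg]
  · rintro _ ⟨g, rfl⟩
    obtain ⟨b, hb, k, hk⟩ := hFX (Fin.append a (g • a))
    exact Set.mem_biUnion hb ⟨g, ⟨k, hk⟩, rfl⟩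

/-- The projections onto the vectors fixed by the stabilisers of two algebraically closed sets
multiply to the projection belonging to the intersection of these sets. -/
theorem starProjection_mem_invariants_inter [CompleteSpace H] (hG : IsOligomorphic G X)
    (hX : HasFiniteIndexFixers G X) (hπ : IsFixerContinuous X π) {A B : Set X}
    (hA : IsAclClosed G A) (hB : IsAclClosed G B) {ξ : H}
    (hξ : ξ ∈ invariants π (fixingSubgroup G A)) :
    (invariants π (fixingSubgroup G B)).starProjection ξ ∈
      invariants π (fixingSubgroup G (A ∩ B)) := by
  have hfin := finite_range_inner_rep hG hA.1 hξ
  set w := (invariants π (fixingSubgroup G B)).starProjection ξ with hw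
  have hwB : w ∈ invariants π (fixingSubgroup G B) := Submodule.starProjection_apply_mem _ _
  have hwA : w ∈ invariants π (fixingSubgroup G A) := by
    refine starProjection_mem_of_finite_norms (Ξ := weakClosure (vectorOrbit π ⊤ ξ)) ?_
      (fun v hv => starProjection_mem_weakClosure hX hπ hfin hA hv)
      (fun v hv => starProjection_mem_weakClosure hX hπ hfin hB hv)
      (subset_weakClosure _ (mem_vectorOrbit_self π ⊤ ξ)) hξ
    refine (hfin.image fun z : ℂ => Real.sqrt z.re).subset ?_
    rintro _ ⟨v, hv, rfl⟩
    exact ⟨_, inner_mem_of_mem_weakClosure_vectorOrbit hfin (fun g => ⟨g, rfl⟩) hv hv,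
      (norm_eq_sqrt_re_inner (𝕜 := ℂ) v).symm⟩
  -- The stabiliser of `w` contains both fixers, so the points of `C` are algebraic over `A` and
  -- over `B`.
  obtain ⟨C, -, hCV, hCx⟩ := hX (vectorStabilizer π w) A hA.1 hwA
  have hCA : C ⊆ A ∩ B := fun x hx =>
    ⟨hA.2 x ((hCx x hx).subset (orbit_mono hwA x)), hB.2 x ((hCx x hx).subset (orbit_mono hwB x))⟩
  exact fun g hg => hCV (fixingSubgroup_anti hCA hg)

/-- The element of minimal norm of the closed convex hull of an orbit is fixed. -/
theorem exists_mem_invariants_norm_sub_le [CompleteSpace H] (V : Subgroup G) {ξ : H} {ε : ℝ}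
    (h : ∀ g ∈ V, ‖π g ξ - ξ‖ ≤ ε) : ∃ η ∈ invariants π V, ‖η - ξ‖ ≤ ε := by
  let _ : InnerProductSpace ℝ H := InnerProductSpace.complexToReal
  set K : Set H := closedConvexHull ℝ (vectorOrbit π V ξ)
  have hKc : IsClosed K := isClosed_closedConvexHull
  have hKconv : Convex ℝ K := convex_closedConvexHull
  have hKinv : ∀ g ∈ V, ∀ v ∈ K, π g v ∈ K := by
    intro g hg
    refine closedConvexHull_min (t := π g ⁻¹' K) ?_ ?_ (hKc.preimage (π g).continuous)
    · rintro _ ⟨k, hk, rfl⟩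
      exact subset_closedConvexHull ⟨g * k, V.mul_mem hg hk, rep_mul π g k ξ⟩
    · exact hKconv.linear_preimage (((π g).toLinearEquiv : H →ₗ[ℂ] H).restrictScalars ℝ)
  have hKne : K.Nonempty := ⟨ξ, subset_closedConvexHull (mem_vectorOrbit_self π V ξ)⟩
  obtain ⟨v, hv, hvmin⟩ := exists_norm_eq_iInf_of_complete_convex hKne hKc.isComplete hKconv 0
  have hmin : ∀ w ∈ K, ‖v‖ ≤ ‖w‖ := by
    intro w hw
    have h1 : ⨅ w : K, ‖(0 : H) - w‖ ≤ ‖(0 : H) - w‖ :=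
      ciInf_le ⟨0, by rintro _ ⟨w, rfl⟩; exact norm_nonneg _⟩ (⟨w, hw⟩ : K)
    rw [← hvmin] at h1
    simpa using h1
  refine ⟨v, fun g hg => ?_, ?_⟩
  -- Strict convexity: the midpoint of two distinct vectors of minimal norm would be shorter.
  · by_contra hne
    have h1 : ‖π g v‖ = ‖v‖ := (π g).norm_map v
    have h2 := (norm_midpoint_lt_iff h1).2 hne
    refine absurd (hmin ((1 / 2 : ℝ) • (π g v + v)) ?_) (by rw [h1] at h2; exact not_le.2 h2)
    rw [smul_add]
    exact hKconv (hKinv g hg v hv) hv (by norm_num) (by norm_num) (by norm_num)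
  · have hsub : K ⊆ Metric.closedBall ξ ε := by
      refine closedConvexHull_min ?_ (convex_closedBall ξ ε) Metric.isClosed_closedBall
      rintro _ ⟨g, hg, rfl⟩
      rw [mem_closedBall_iff_norm]
      exact h g hg
    exact mem_closedBall_iff_norm.1 (hsub hv)

variable (G X) in
/-- The algebraically closed finite sets. -/
abbrev AclClosedSet := {A : Set X // IsAclClosed G A}

instance : MulAction G (AclClosedSet G X) where
  smul g A := ⟨(g • ·) '' A.1, A.2.smul g⟩
  one_smul A := Subtype.ext (one_smul G A.1)
  mul_smul g h A := Subtype.ext (mul_smul g h A.1)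

theorem AclClosedSet.mem_smul_iff {g : G} {A : AclClosedSet G X} {x : X} :
    x ∈ (g • A).1 ↔ g⁻¹ • x ∈ A.1 := Set.mem_smul_set_iff_inv_smul_mem

theorem AclClosedSet.smul_lt_smul {g : G} {A B : AclClosedSet G X} (h : A < B) :
    g • A < g • B := by
  refine lt_of_le_of_ne (Set.image_mono h.le) fun he => h.ne ?_
  exact smul_left_cancel g he

variable (π) in
/-- The vectors fixed by the stabiliser of `A` that are orthogonal to those fixed by the stabiliser
of a smaller algebraically closed set. -/
noncomputable def newVectors (A : AclClosedSet G X) : Submodule ℂ H :=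
  invariants π (fixingSubgroup G A.1) ⊓
    (⨆ C : AclClosedSet G X, ⨆ _ : C < A, invariants π (fixingSubgroup G C.1))ᗮ

theorem mem_newVectors_iff {A : AclClosedSet G X} {ξ : H} :
    ξ ∈ newVectors π A ↔ ξ ∈ invariants π (fixingSubgroup G A.1) ∧
      ∀ C < A, ∀ η ∈ invariants π (fixingSubgroup G C.1), inner ℂ η ξ = 0 := by
  rw [newVectors, Submodule.mem_inf, Submodule.mem_orthogonal]
  refine and_congr_right fun _ => ⟨fun h C hC η hη => h η ?_, fun h η hη => ?_⟩
  · exact Submodule.mem_iSup_of_mem C (Submodule.mem_iSup_of_mem hC hη)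
  · have : (⨆ C : AclClosedSet G X, ⨆ _ : C < A, invariants π (fixingSubgroup G C.1)) ≤
        (Submodule.span ℂ {ξ})ᗮ := iSup₂_le fun C hC ζ hζ => by
      rw [Submodule.mem_orthogonal_singleton_iff_inner_left]
      exact h C hC ζ hζ
    exact Submodule.mem_orthogonal_singleton_iff_inner_left.1 (this hη)

instance [CompleteSpace H] (A : AclClosedSet G X) : CompleteSpace (newVectors π A) :=
  (show IsClosed (newVectors π A : Set H) from
    (isClosed_invariants π _).inter (Submodule.isClosed_orthogonal _)).completeSpace_coe

theorem rep_mem_invariants {A : AclClosedSet G X} {ξ : H}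
    (hξ : ξ ∈ invariants π (fixingSubgroup G A.1)) (g : G) :
    π g ξ ∈ invariants π (fixingSubgroup G (g • A).1) := by
  intro h hh
  have h1 : g⁻¹ * h * g ∈ fixingSubgroup G A.1 := by
    rw [mem_fixingSubgroup_iff] at hh ⊢
    intro x hx
    rw [mul_smul, mul_smul, hh (g • x) ⟨x, hx, rfl⟩, inv_smul_smul]
  calc π h (π g ξ) = π g (π (g⁻¹ * h * g) ξ) := by
        rw [← rep_mul, ← rep_mul]; congr 2; group
    _ = π g ξ := by rw [hξ _ h1]

theorem rep_mem_newVectors {A : AclClosedSet G X} {ξ : H} (hξ : ξ ∈ newVectors π A) (g : G) :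
    π g ξ ∈ newVectors π (g • A) := by
  rw [mem_newVectors_iff] at hξ ⊢
  refine ⟨rep_mem_invariants hξ.1 g, fun C hC η hη => ?_⟩
  have h1 := hξ.2 (g⁻¹ • C) (by simpa using AclClosedSet.smul_lt_smul (g := g⁻¹) hC) _
    (rep_mem_invariants hη g⁻¹)
  rwa [inner_rep_left, inv_inv] at h1

theorem starProjection_newVectors_rep [CompleteSpace H] (A : AclClosedSet G X) (ξ : H) (g : G) :
    (newVectors π (g • A)).starProjection (π g ξ) = π g ((newVectors π A).starProjection ξ) := by
  refine Submodule.eq_starProjection_of_mem_of_inner_eq_zero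
    (rep_mem_newVectors (Submodule.starProjection_apply_mem _ _) g) fun η hη => ?_
  rw [← map_sub, inner_rep_left]
  refine Submodule.starProjection_inner_eq_zero _ _ ?_
  simpa using rep_mem_newVectors hη g⁻¹

/-- If `A ⊄ B`, project `ξ` from the space of `A` to the `G_B`-fixed vectors. The image `w` is fixed
by the fixer of `A ∩ B ⊊ A`, to which `ξ` is orthogonal, so `‖w‖² = ⟨w, ξ⟩ = 0`. -/
theorem newVectors_isOrtho [CompleteSpace H] (hG : IsOligomorphic G X)
    (hX : HasFiniteIndexFixers G X) (hπ : IsFixerContinuous X π) {A B : AclClosedSet G X}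
    (hAB : A ≠ B) : newVectors π A ⟂ newVectors π B := by
  have key : ∀ A B : AclClosedSet G X, ¬ A ≤ B → newVectors π A ⟂ newVectors π B := by
    intro A B hle
    rw [Submodule.isOrtho_iff_inner_eq]
    intro ξ hξ η hη
    rw [mem_newVectors_iff] at hξ hη
    let C : AclClosedSet G X := ⟨A.1 ∩ B.1, A.2.inter B.2⟩
    have hC : C < A := lt_of_le_of_ne (Set.inter_subset_left : A.1 ∩ B.1 ⊆ A.1) fun h =>
      hle (h ▸ (Set.inter_subset_right : A.1 ∩ B.1 ⊆ B.1))
    set w := (invariants π (fixingSubgroup G B.1)).starProjection ξ with hw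
    have hwC : w ∈ invariants π (fixingSubgroup G C.1) :=
      starProjection_mem_invariants_inter hG hX hπ A.2 B.2 hξ.1
    have hw0 : w = 0 := by
      have h1 := hξ.2 C hC w hwC
      have hPw : (invariants π (fixingSubgroup G B.1)).starProjection w = w :=
        Submodule.starProjection_eq_self_iff.2 (Submodule.starProjection_apply_mem _ ξ)
      rw [← inner_self_eq_zero (𝕜 := ℂ)]
      nth_rw 2 [hw]
      rw [← Submodule.inner_starProjection_left_eq_right, hPw, h1]
    rw [← Submodule.starProjection_eq_self_iff.2 hη.1,
      ← Submodule.inner_starProjection_left_eq_right, ← hw, hw0, inner_zero_left]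
  by_cases h : A ≤ B
  · exact (key B A fun h' => hAB (le_antisymm h h')).symm
  · exact key A B h

/-- Induction on the size of `A` splits a `G_A`-fixed vector into a new part and a limit of sums of
vectors fixed by fixers of smaller sets. Vectors with such fixers are dense: by continuity some
fixer moves `ξ` little, and the closed convex hull of that small orbit contains a fixed vector. -/
theorem topologicalClosure_iSup_newVectors [CompleteSpace H] (hG : IsOligomorphic G X)
    (hπ : IsFixerContinuous X π) :
    (⊤ : Submodule ℂ H) ≤ (⨆ A : AclClosedSet G X, newVectors π A).topologicalClosure := by
  set M := (⨆ A : AclClosedSet G X, newVectors π A).topologicalClosure with hM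
  have hMc : IsClosed (M : Set H) := Submodule.isClosed_topologicalClosure _
  have key : ∀ n, ∀ A : AclClosedSet G X, A.1.ncard = n →
      invariants π (fixingSubgroup G A.1) ≤ M := by
    intro n
    induction n using Nat.strong_induction_on with
    | _ n ih =>
    intro A hA ξ hξ
    set N := ⨆ C : AclClosedSet G X, ⨆ _ : C < A, invariants π (fixingSubgroup G C.1) with hN
    have hNM : N ≤ M := iSup₂_le fun C hC =>
      ih _ (hA ▸ Set.ncard_lt_ncard hC A.2.1) C rfl
    have hNA : N ≤ invariants π (fixingSubgroup G A.1) := iSup₂_le fun C hC =>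
      invariants_anti π (fixingSubgroup_anti hC.le)
    have hNM' : N.topologicalClosure ≤ M := N.topologicalClosure_minimal hNM hMc
    have hNA' := N.topologicalClosure_minimal hNA (isClosed_invariants π _)
    have : CompleteSpace N.topologicalClosure :=
      N.isClosed_topologicalClosure.completeSpace_coe
    set p := N.topologicalClosure.starProjection ξ
    have hp : p ∈ N.topologicalClosure := Submodule.starProjection_apply_mem _ _
    have hq : ξ - p ∈ newVectors π A := by
      refine ⟨Submodule.sub_mem _ hξ (hNA' hp), ?_⟩
      rw [← hN, ← Submodule.orthogonal_closure]
      exact Submodule.sub_starProjection_mem_orthogonal _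
    have hq' : ξ - p ∈ M := Submodule.le_topologicalClosure _ (Submodule.mem_iSup_of_mem A hq)
    simpa using M.add_mem hq' (hNM' hp)
  intro ξ _
  refine hMc.closure_subset (Metric.mem_closure_iff.2 fun ε hε => ?_)
  obtain ⟨A₀, hA₀, hξ⟩ := hπ ξ (ε / 2) (by positivity)
  obtain ⟨A, hAA, hA⟩ := hG.exists_isAclClosed hA₀
  obtain ⟨η, hη, hηξ⟩ := exists_mem_invariants_norm_sub_le (π := π) (fixingSubgroup G A)
    fun g hg => (hξ g (fixingSubgroup_anti hAA hg)).le
  refine ⟨η, key _ ⟨A, hA⟩ rfl hη, ?_⟩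
  rw [dist_comm, dist_eq_norm]
  linarith

/-- Parseval's identity for a dense orthogonal family of closed subspaces. -/
theorem hasSum_norm_sq_starProjection [CompleteSpace H] {I : Type*} (K : I → Submodule ℂ H)
    [∀ i, CompleteSpace (K i)] (hK : Pairwise fun i j => K i ⟂ K j)
    (hd : (⊤ : Submodule ℂ H) ≤ (⨆ i, K i).topologicalClosure) (ξ : H) :
    HasSum (fun i => ‖(K i).starProjection ξ‖ ^ 2) (‖ξ‖ ^ 2) := by
  classical
  have hV := IsHilbertSum.mkInternal K (OrthogonalFamily.of_pairwise hK) hd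
  set W := hV.linearIsometryEquiv with hW
  have h1 := lp.hasSum_norm (p := 2) (by norm_num) (W ξ)
  rw [W.norm_map] at h1
  simp only [ENNReal.toReal_ofNat, Real.rpow_ofNat] at h1
  convert h1 using 2 with i
  congr 1
  have h2 : (K i).starProjection ξ = (W ξ i : H) := by
    refine Submodule.eq_starProjection_of_mem_of_inner_eq_zero (W ξ i).2 fun η hη => ?_
    have h3 : inner ℂ (W ξ) (lp.single 2 i (⟨η, hη⟩ : K i)) = inner ℂ ξ η := by
      rw [← W.symm.inner_map_map, W.symm_apply_apply, hV.linearIsometryEquiv_symm_apply_single]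
      rfl
    rw [lp.inner_single_right] at h3
    rw [inner_sub_left, ← h3]
    exact sub_self _
  rw [h2]
  rfl

end Decomposition

/-! ### From weights on index sets to functions in `ℓ¹₊`. -/

section Transport

open scoped ENNReal

variable {I : Type*} {Y : Type w}

/-- The average of the functions `w A` on `Y` with respect to the weights `q A`. -/
noncomputable def mixture (q : I → ℝ) (w : I → Y → ℝ) (y : Y) : ℝ := ∑' A, q A * w A y

variable {q : I → ℝ} {w : I → Y → ℝ}

theorem summable_mixture (hq : ∀ A, 0 ≤ q A) (hw : ∀ A y, 0 ≤ w A y) (hqs : HasSum q 1)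
    (hws : ∀ A, q A ≠ 0 → HasSum (w A) 1) :
    HasSum (fun p : I × Y => q p.1 * w p.1 p.2) 1 := by
  have hfib : ∀ A, HasSum (fun y => q A * w A y) (q A) := by
    intro A
    by_cases hA : q A = 0
    · simp only [hA, zero_mul]
      exact hasSum_zero
    · simpa using (hws A hA).mul_left (q A)
  have hs : Summable fun p : I × Y => q p.1 * w p.1 p.2 := by
    refine (summable_prod_of_nonneg fun p => mul_nonneg (hq _) (hw _ _)).2
      ⟨fun A => (hfib A).summable, ?_⟩
    simp only [(hfib _).tsum_eq]
    exact hqs.summable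
  have h1 := hs.hasSum.prod_fiberwise hfib
  rw [← h1.unique hqs]
  exact hs.hasSum

theorem mixture_mem_ellOnePlus (hq : ∀ A, 0 ≤ q A) (hw : ∀ A y, 0 ≤ w A y) (hqs : HasSum q 1)
    (hws : ∀ A, q A ≠ 0 → HasSum (w A) 1) : mixture q w ∈ ellOnePlus Y := by
  refine ⟨fun y => tsum_nonneg fun A => mul_nonneg (hq A) (hw A y), ?_⟩
  have h1 := (Equiv.prodComm Y I).hasSum_iff.2 (summable_mixture hq hw hqs hws)
  exact h1.prod_fiberwise fun y => (h1.summable.prod_factor y).hasSum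

/-- By equivariance of `w`, translating the mixture amounts to translating the weights `q`; the
triangle inequality finishes, since each `w A` has mass at most `1`. -/
theorem ellOneDisplacement_mixture_le {G : Type*} [Group G] [MulAction G I] [MulAction G Y]
    (hq : ∀ A, 0 ≤ q A) (hw : ∀ A y, 0 ≤ w A y) (hqs : HasSum q 1)
    (hws : ∀ A, q A ≠ 0 → HasSum (w A) 1) (hw1 : ∀ A, ∑' y, ENNReal.ofReal (w A y) ≤ 1)
    (hwg : ∀ (g : G) A y, w (g • A) (g • y) = w A y) (g : G) :
    ellOneDisplacement g (mixture q w) ≤ ∑' A, ‖q (g⁻¹ • A) - q A‖ₑ := by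
  have hs : ∀ y, Summable fun A => q A * w A y := fun y =>
    ((Equiv.prodComm Y I).hasSum_iff.2 (summable_mixture hq hw hqs hws)).summable.prod_factor y
  have hreindex : ∀ y A, q (g⁻¹ • A) * w (g⁻¹ • A) (g⁻¹ • y) = q (g⁻¹ • A) * w A y :=
    fun y A => by rw [hwg]
  have hs' : ∀ y, Summable fun A => q (g⁻¹ • A) * w A y := fun y => by
    simp only [← hreindex]
    exact (MulAction.toPerm (g⁻¹) : Equiv.Perm I).summable_iff.2 (hs (g⁻¹ • y))
  have hdiff : ∀ y, mixture q w (g⁻¹ • y) - mixture q w y =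
      ∑' A, (q (g⁻¹ • A) - q A) * w A y := by
    intro y
    simp only [sub_mul]
    rw [(hs' y).tsum_sub (hs y)]
    congr 1
    simp only [← hreindex]
    exact ((MulAction.toPerm (g⁻¹) : Equiv.Perm I).tsum_eq
      fun A => q A * w A (g⁻¹ • y)).symm
  calc ellOneDisplacement g (mixture q w)
      ≤ ∑' y, ∑' A, ‖q (g⁻¹ • A) - q A‖ₑ * ENNReal.ofReal (w A y) := by
        refine ENNReal.tsum_le_tsum fun y => ?_
        rw [hdiff]
        refine (enorm_tsum_le_tsum_enorm).trans (ENNReal.tsum_le_tsum fun A => ?_)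
        rw [enorm_mul, Real.enorm_of_nonneg (hw A y)]
    _ = ∑' A, ‖q (g⁻¹ • A) - q A‖ₑ * ∑' y, ENNReal.ofReal (w A y) := by
        rw [ENNReal.tsum_comm]
        simp only [ENNReal.tsum_mul_left]
    _ ≤ ∑' A, ‖q (g⁻¹ • A) - q A‖ₑ := by
        refine ENNReal.tsum_le_tsum fun A => ?_
        calc _ ≤ ‖q (g⁻¹ • A) - q A‖ₑ * 1 := by gcongr; exact hw1 A
          _ = _ := mul_one _

/-- The variation of the squared coordinates of a unit vector with respect to an orthogonal
decomposition is controlled by the variation of the vector. -/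
theorem tsum_enorm_norm_sq_sub_le {H : Type*} [NormedAddCommGroup H] [InnerProductSpace ℂ H]
    [CompleteSpace H] {K : I → Submodule ℂ H} [∀ i, CompleteSpace (K i)]
    (hK : ∀ ξ : H, HasSum (fun i => ‖(K i).starProjection ξ‖ ^ 2) (‖ξ‖ ^ 2)) {ξ η : H}
    (hξ : ‖ξ‖ = 1) (hη : ‖η‖ = 1) {t : ℝ} (ht : 0 < t) (h : ‖ξ - η‖ ≤ t) :
    ∑' i, ‖‖(K i).starProjection ξ‖ ^ 2 - ‖(K i).starProjection η‖ ^ 2‖ₑ ≤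
      ENNReal.ofReal (3 * t) := by
  -- With `x`, `y`, `d` the norms of the components of `ξ`, `η`, `ξ - η`: `|x² - y²| ≤ d (x + y) ≤
  -- (2t)⁻¹ (d² + t² (x + y)²)`, and `(x + y)² ≤ 2 (x² + y²)`. The total is at most `5t/2`, below
  -- `3t`.
  let b : I → ℝ := fun i => (2 * t)⁻¹ * (‖(K i).starProjection (ξ - η)‖ ^ 2 +
    2 * t ^ 2 * (‖(K i).starProjection ξ‖ ^ 2 + ‖(K i).starProjection η‖ ^ 2))
  have hb : HasSum b ((2 * t)⁻¹ * (‖ξ - η‖ ^ 2 + 2 * t ^ 2 * (‖ξ‖ ^ 2 + ‖η‖ ^ 2))) :=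
    ((hK _).add (((hK ξ).add (hK η)).mul_left _)).mul_left _
  have hb0 : ∀ i, 0 ≤ b i := fun i => by positivity
  have hle : ∀ i, |‖(K i).starProjection ξ‖ ^ 2 - ‖(K i).starProjection η‖ ^ 2| ≤ b i := by
    intro i
    set x := ‖(K i).starProjection ξ‖
    set y := ‖(K i).starProjection η‖
    set d := ‖(K i).starProjection (ξ - η)‖ with hd
    have hxy : |x - y| ≤ d := by
      rw [hd, map_sub]
      exact abs_norm_sub_norm_le _ _
    have hx : 0 ≤ x := norm_nonneg _
    have hy : 0 ≤ y := norm_nonneg _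
    have h1 : |x ^ 2 - y ^ 2| ≤ d * (x + y) := by
      rw [sq_sub_sq, abs_mul, abs_of_nonneg (add_nonneg hx hy), mul_comm]
      gcongr
    refine h1.trans ?_
    change d * (x + y) ≤ (2 * t)⁻¹ * (d ^ 2 + 2 * t ^ 2 * (x ^ 2 + y ^ 2))
    rw [inv_mul_eq_div, le_div_iff₀ (by positivity)]
    nlinarith [sq_nonneg (d - t * (x + y)), mul_nonneg (sq_nonneg t) (sq_nonneg (x - y))]
  calc _ ≤ ∑' i, ENNReal.ofReal (b i) := by
        refine ENNReal.tsum_le_tsum fun i => ?_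
        rw [Real.enorm_eq_ofReal_abs]
        exact ENNReal.ofReal_le_ofReal (hle i)
    _ = ENNReal.ofReal (∑' i, b i) := (ENNReal.ofReal_tsum_of_nonneg hb0 hb.summable).symm
    _ ≤ ENNReal.ofReal (3 * t) := by
        refine ENNReal.ofReal_le_ofReal ?_
        rw [hb.tsum_eq, hξ, hη, inv_mul_eq_div, div_le_iff₀ (by positivity)]
        nlinarith [norm_nonneg (ξ - η)]

end Transport

/-! ### Uniform measures, and almost invariant functions from almost invariant vectors. -/

section UniformMeasures

variable {G : Type*} [Group G] {X : Type*} [MulAction G X] (Y : SubMulAction G X)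

/-- The density of the uniform probability measure on the set of the points of `Y` lying in `A`. -/
noncomputable def uniformOn (A : AclClosedSet G X) : Y → ℝ :=
  Set.indicator {y : Y | (y : X) ∈ A.1} fun _ => (({y : Y | (y : X) ∈ A.1}.ncard : ℝ))⁻¹

variable {Y}

theorem uniformOn_nonneg (A : AclClosedSet G X) (y : Y) : 0 ≤ uniformOn Y A y :=
  Set.indicator_nonneg (fun _ _ => by positivity) y

theorem AclClosedSet.finite_coe_mem (A : AclClosedSet G X) : {y : Y | (y : X) ∈ A.1}.Finite :=
  A.2.1.preimage Subtype.val_injective.injOn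

theorem hasSum_uniformOn {A : AclClosedSet G X} (hA : {y : Y | (y : X) ∈ A.1}.Nonempty) :
    HasSum (uniformOn Y A) 1 := by
  have hfin := A.finite_coe_mem (Y := Y)
  have h1 : HasSum (uniformOn Y A) (∑ y ∈ hfin.toFinset, uniformOn Y A y) :=
    hasSum_sum_of_ne_finset_zero fun y hy => Set.indicator_of_notMem (by simpa using hy) _
  have h2 : ∑ y ∈ hfin.toFinset, uniformOn Y A y = 1 := by
    have h3 : ∀ y ∈ hfin.toFinset, uniformOn Y A y = (({y : Y | (y : X) ∈ A.1}.ncard : ℝ))⁻¹ :=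
      fun y hy => Set.indicator_of_mem (hfin.mem_toFinset.1 hy) _
    rw [Finset.sum_congr rfl h3, Finset.sum_const, nsmul_eq_mul, ← Set.ncard_eq_toFinset_card _ hfin]
    exact mul_inv_cancel₀ (by
      rw [Nat.cast_ne_zero]
      exact (Set.ncard_pos hfin).2 hA |>.ne')
  rwa [h2] at h1

theorem tsum_ofReal_uniformOn_le (A : AclClosedSet G X) :
    ∑' y, ENNReal.ofReal (uniformOn Y A y) ≤ 1 := by
  rcases Set.eq_empty_or_nonempty {y : Y | (y : X) ∈ A.1} with h | h
  · simp [uniformOn, h]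
  · have h1 := hasSum_uniformOn h
    rw [← ENNReal.ofReal_tsum_of_nonneg (uniformOn_nonneg A) h1.summable, h1.tsum_eq]
    simp

theorem uniformOn_smul (g : G) (A : AclClosedSet G X) (y : Y) :
    uniformOn Y (g • A) (g • y) = uniformOn Y A y := by
  have h1 : {y : Y | (y : X) ∈ (g • A).1} = (g • ·) '' {y : Y | (y : X) ∈ A.1} := by
    ext z
    constructor
    · intro hz
      refine ⟨g⁻¹ • z, ?_, smul_inv_smul _ _⟩
      have : g⁻¹ • (z : X) ∈ A.1 := AclClosedSet.mem_smul_iff.1 hz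
      exact this
    · rintro ⟨z, hz, rfl⟩
      exact ⟨(z : X), hz, rfl⟩
  unfold uniformOn
  rw [h1, Set.ncard_image_of_injective _ (MulAction.injective g)]
  by_cases hy : (y : X) ∈ A.1
  · have hgy : g • y ∈ (g • ·) '' {y : Y | (y : X) ∈ A.1} := ⟨y, hy, rfl⟩
    rw [Set.indicator_of_mem hgy, Set.indicator_of_mem (by exact hy)]
  · rw [Set.indicator_of_notMem, Set.indicator_of_notMem (by exact hy)]
    rintro ⟨z, hz, hzy⟩
    exact hy (MulAction.injective g hzy ▸ hz)

/-- A unit vector moved by at most `t` by each element of `Q`, in a representation without invariant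
vectors, yields a function in `ℓ¹₊(Y)` moved by at most `3 t`. -/
theorem ellOneConstant_le_of_almost_invariant {H : Type*} [NormedAddCommGroup H]
    [InnerProductSpace ℂ H] [CompleteSpace H] {π : G →* (H ≃ₗᵢ[ℂ] H)}
    (hG : IsOligomorphic G X) (hX : HasFiniteIndexFixers G X) (hπ : IsFixerContinuous X π)
    (hY : ∀ x ∉ Y, ∀ g : G, g • x = x) (hinv : ∀ ξ, (∀ g, π g ξ = ξ) → ξ = 0) {Q : Set G} {ξ : H}
    (hξ : ‖ξ‖ = 1) {t : ℝ} (ht : 0 < t) (hQ : ∀ g ∈ Q, ‖π g ξ - ξ‖ ≤ t) :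
    ellOneConstant Y Q ≤ ENNReal.ofReal (3 * t) := by
  have hK := hasSum_norm_sq_starProjection (fun A : AclClosedSet G X => newVectors π A)
    (fun A B hAB => newVectors_isOrtho hG hX hπ hAB) (topologicalClosure_iSup_newVectors hG hπ)
  let q : AclClosedSet G X → ℝ := fun A => ‖(newVectors π A).starProjection ξ‖ ^ 2
  have hq0 : ∀ A, 0 ≤ q A := fun A => sq_nonneg _
  have hq1 : HasSum q 1 := by simpa [hξ] using hK ξ
  have hw1 : ∀ A, q A ≠ 0 → HasSum (uniformOn Y A) 1 := by
    intro A hA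
    refine hasSum_uniformOn ?_
    by_contra hne
    rw [Set.not_nonempty_iff_eq_empty] at hne
    have hP : (newVectors π A).starProjection ξ ∈ newVectors π A :=
      Submodule.starProjection_apply_mem _ _
    -- If `A` misses `Y`, all its points are fixed by `G`, so its fixer is `G`; the component of `ξ`
    -- is invariant and hence zero.
    have h0 := hinv _ fun g => (mem_newVectors_iff.1 hP).1 g (by
      rw [mem_fixingSubgroup_iff]
      intro x hx
      refine hY x (fun hxY => ?_) g
      exact (Set.eq_empty_iff_forall_notMem.1 hne ⟨x, hxY⟩) hx)
    exact hA (by simp [q, h0])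
  refine (iInf₂_le _ (mixture_mem_ellOnePlus hq0 uniformOn_nonneg hq1 hw1)).trans
    (iSup₂_le fun g hg => ?_)
  refine (ellOneDisplacement_mixture_le hq0 uniformOn_nonneg hq1 hw1 tsum_ofReal_uniformOn_le
    uniformOn_smul g).trans ?_
  have h1 : ∀ A, q (g⁻¹ • A) = ‖(newVectors π A).starProjection (π g ξ)‖ ^ 2 := by
    intro A
    have := starProjection_newVectors_rep (π := π) A (π g ξ) g⁻¹
    rw [rep_inv_self] at this
    simp only [q, this, LinearIsometryEquiv.norm_map]
  simp only [h1]
  exact tsum_enorm_norm_sq_sub_le hK (by rw [LinearIsometryEquiv.norm_map, hξ]) hξ ht (hQ g hg)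

end UniformMeasures

/-! ### The permutation representation on `ℓ²` and the converse. -/

section PermutationRepresentation

open scoped ENNReal

variable {Z : Type x}

/-- The Hilbert space of square-summable functions. -/
abbrev EllTwo (Z : Type x) : Type x := lp (fun _ : Z => ℂ) 2

theorem memlp_two_iff {f : Z → ℂ} : Memℓp f 2 ↔ Summable fun z => ‖f z‖ ^ 2 := by
  rw [memℓp_gen_iff (by norm_num)]
  simp

theorem ellTwo_hasSum_norm_sq (f : EllTwo Z) : HasSum (fun z => ‖f z‖ ^ 2) (‖f‖ ^ 2) := by
  have := lp.hasSum_norm (p := 2) (by norm_num) f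
  simpa using this

/-- A permutation of the index set acts on `ℓ²`. -/
noncomputable def ellTwoPerm (σ : Equiv.Perm Z) : EllTwo Z →ₗᵢ[ℂ] EllTwo Z where
  toFun f := ⟨fun z => f (σ.symm z), memlp_two_iff.2
    (σ.symm.summable_iff.2 (ellTwo_hasSum_norm_sq f).summable)⟩
  map_add' f g := rfl
  map_smul' c f := rfl
  norm_map' f := by
    refine (sq_eq_sq₀ (norm_nonneg _) (norm_nonneg _)).1 ?_
    refine (ellTwo_hasSum_norm_sq _).unique ?_
    exact σ.symm.hasSum_iff.2 (ellTwo_hasSum_norm_sq f)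

variable {G : Type w} [Group G]

/-- The permutation representation on `ℓ²`. -/
noncomputable def ellTwoRep (ρ : G →* Equiv.Perm Z) : G →* (EllTwo Z ≃ₗᵢ[ℂ] EllTwo Z) where
  toFun g :=
    { (ellTwoPerm (ρ g)) with
      invFun := ellTwoPerm (ρ g)⁻¹
      left_inv := fun f => lp.ext (funext fun z => congrArg f ((ρ g).symm_apply_apply z))
      right_inv := fun f => lp.ext (funext fun z => congrArg f ((ρ g).apply_symm_apply z)) }
  map_one' := by
    ext f z
    change f ((ρ 1).symm z) = f z
    rw [map_one]; rfl
  map_mul' g h := by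
    ext f z
    change f ((ρ (g * h)).symm z) = f ((ρ h).symm ((ρ g).symm z))
    rw [map_mul]; rfl

theorem ellTwoRep_apply (ρ : G →* Equiv.Perm Z) (g : G) (f : EllTwo Z) (z : Z) :
    ellTwoRep ρ g f z = f ((ρ g)⁻¹ z) := rfl

theorem ellTwoRep_single [DecidableEq Z] (ρ : G →* Equiv.Perm Z) (g : G) (z : Z) (c : ℂ) :
    ellTwoRep ρ g (lp.single 2 z c) = lp.single 2 (ρ g z) c := by
  ext y
  rw [ellTwoRep_apply]
  by_cases h : y = ρ g z
  · subst h
    simp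
  · rw [lp.single_apply_ne _ _ _ h, lp.single_apply_ne]
    intro h'
    exact h (by rw [← h']; simp)

theorem continuous_ellTwoRep [TopologicalSpace G] (ρ : G →* Equiv.Perm Z)
    (hρ : ∀ z z', IsOpen {g | ρ g z = z'}) (ξ : EllTwo Z) :
    Continuous fun g => ellTwoRep ρ g ξ := by
  classical
  have hsingle : ∀ z c, Continuous fun g => ellTwoRep ρ g (lp.single 2 z c) := by
    intro z c
    simp only [ellTwoRep_single]
    let _ : TopologicalSpace Z := ⊥
    have : DiscreteTopology Z := ⟨rfl⟩
    exact (continuous_of_discreteTopology (f := fun z => (lp.single 2 z c : EllTwo Z))).comp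
      (continuous_discrete_rng.2 fun z' => hρ z z')
  have hsum := lp.hasSum_single (p := 2) (by norm_num) ξ
  -- The operators are isometries, so approximating `ξ` by finitely supported vectors is uniform in
  -- `g`.
  refine continuous_of_uniform_approx_of_continuous fun U hU => ?_
  obtain ⟨ε, hε, hεU⟩ := Metric.mem_uniformity_dist.1 hU
  obtain ⟨s, hs⟩ := (Metric.tendsto_nhds.1 hsum ε hε).exists
  refine ⟨fun g => ellTwoRep ρ g (∑ z ∈ s, lp.single 2 z (ξ z)), ?_, fun g => hεU ?_⟩
  · simp only [map_sum]
    exact continuous_finsetSum _ fun z _ => hsingle z _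
  · rw [LinearIsometryEquiv.dist_map, dist_comm]
    exact hs

/-- A square-summable function that is invariant under an action with infinite orbits vanishes. -/
theorem ellTwo_eq_zero_of_invariant (ρ : G →* Equiv.Perm Z)
    (hρ : ∀ z, (Set.range fun g => ρ g z).Infinite) {ξ : EllTwo Z}
    (hξ : ∀ g, ellTwoRep ρ g ξ = ξ) : ξ = 0 := by
  ext z
  by_contra hz
  have hpos : 0 < ‖ξ z‖ ^ 2 := by
    have : 0 < ‖ξ z‖ := norm_pos_iff.2 hz
    positivity
  have hev := (ellTwo_hasSum_norm_sq ξ).summable.tendsto_cofinite_zero.eventually_lt_const hpos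
  rw [Filter.eventually_cofinite] at hev
  refine hρ z (hev.subset ?_)
  rintro _ ⟨g, rfl⟩
  have h1 : ξ (ρ g z) = ξ z := by
    conv_lhs => rw [← hξ g, ellTwoRep_apply]
    simp
  simp [h1]

/-- Since `|√a - √b| ≤ √a + √b`. This bounds the squared `ℓ²`-displacement of `√f` by the
`ℓ¹`-displacement of `f`, whence the threshold `ε ^ 2` below. -/
theorem norm_sqrt_sub_sqrt_sq_le (a b : ℝ) (ha : 0 ≤ a) (hb : 0 ≤ b) :
    ‖((√a : ℝ) : ℂ) - ((√b : ℝ) : ℂ)‖ ^ 2 ≤ |a - b| := by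
  rw [← Complex.ofReal_sub, Complex.norm_real, Real.norm_eq_abs]
  have h1 : |a - b| = |√a - √b| * (√a + √b) := by
    rw [← abs_of_nonneg (add_nonneg (Real.sqrt_nonneg a) (Real.sqrt_nonneg b)), ← abs_mul]
    congr 1
    nlinarith [Real.sq_sqrt ha, Real.sq_sqrt hb]
  rw [h1, sq]
  gcongr
  rw [abs_le]
  constructor <;> linarith [Real.sqrt_nonneg a, Real.sqrt_nonneg b]

/-- If the action of `G` on `Y` has open stabilisers and infinite orbits and `Q` belongs to a Kazhdan
pair, then no function in `ℓ¹₊(Y)` is moved only little by all elements of `Q`. -/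
theorem ellOneConstant_pos_of_isKazhdanPair [TopologicalSpace G] {Y : Type w} [MulAction G Y]
    [Countable Y] (hopen : ∀ y y' : Y, IsOpen {g : G | g • y = y'})
    (hinf : ∀ y : Y, (MulAction.orbit G y).Infinite) {Q : Set G} {ε : ℝ} (hε : 0 < ε)
    (hQ : IsKazhdanPair.{w, x} Q ε) : 0 < ellOneConstant Y Q := by
  -- Countability allows a copy of `Y` in the universe of the Hilbert spaces over which `hQ`
  -- quantifies.
  have : Small.{x} Y := Countable.toSmall Y
  let e : Y ≃ Shrink.{x} Y := equivShrink Y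
  let ρ : G →* Equiv.Perm (Shrink.{x} Y) :=
    (e.permCongrHom.toMonoidHom).comp (MulAction.toPermHom G Y)
  have hρ : ∀ g z, ρ g z = e (g • e.symm z) := fun g z => rfl
  have hρ' : ∀ g z, (ρ g)⁻¹ z = e (g⁻¹ • e.symm z) := fun g z => by rw [← map_inv]; rfl
  let π : UnitaryRep G (EllTwo (Shrink.{x} Y)) :=
    { hom := ellTwoRep ρ
      strongly_continuous := continuous_ellTwoRep ρ fun z z' => by
        have : {g | ρ g z = z'} = {g : G | g • e.symm z = e.symm z'} := by
          ext g
          simp only [Set.mem_ofPred_eq, hρ]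
          exact (Equiv.eq_symm_apply e).symm
        rw [this]
        exact hopen _ _ }
  by_contra hcon
  have hlt : ellOneConstant Y Q < ENNReal.ofReal (ε ^ 2) := by
    rw [nonpos_iff_eq_zero.1 (not_lt.1 hcon)]
    exact ENNReal.ofReal_pos.2 (by positivity)
  obtain ⟨f, hf⟩ := iInf_lt_iff.1 hlt
  obtain ⟨⟨hf0, hf1⟩, hf⟩ := iInf_lt_iff.1 hf
  have hnorm : ∀ z, ‖((√(f (e.symm z)) : ℝ) : ℂ)‖ ^ 2 = f (e.symm z) := fun z => by
    rw [Complex.norm_real, Real.norm_eq_abs, sq_abs, Real.sq_sqrt (hf0 _)]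
  let ξ : EllTwo (Shrink.{x} Y) := ⟨fun z => ((√(f (e.symm z)) : ℝ) : ℂ), memlp_two_iff.2 (by
    simp only [hnorm]
    exact e.symm.summable_iff.2 hf1.summable)⟩
  have hξ : ‖ξ‖ = 1 := by
    have h1 : ‖ξ‖ ^ 2 = 1 := by
      refine (ellTwo_hasSum_norm_sq ξ).unique ?_
      change HasSum (fun z => ‖((√(f (e.symm z)) : ℝ) : ℂ)‖ ^ 2) 1
      simp only [hnorm]
      exact e.symm.hasSum_iff.2 hf1
    exact (pow_eq_one_iff_of_nonneg (norm_nonneg ξ) two_ne_zero).1 h1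
  have halmost : π.IsAlmostInvariant Q ε ξ := by
    refine ⟨fun h => by simp [h] at hξ, fun g hg => ?_⟩
    rw [hξ, mul_one]
    have hdisp : ellOneDisplacement g f < ENNReal.ofReal (ε ^ 2) :=
      (le_iSup₂ (f := fun g (_ : g ∈ Q) => ellOneDisplacement g f) g hg).trans_lt hf
    have hs : Summable fun y => |f (g⁻¹ • y) - f y| :=
      (((MulAction.toPerm g⁻¹ : Equiv.Perm Y).summable_iff.2 hf1.summable).sub
        hf1.summable).abs
    have hsum : ∑' y, |f (g⁻¹ • y) - f y| < ε ^ 2 := by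
      rw [ellOneDisplacement] at hdisp
      simp only [Real.enorm_eq_ofReal_abs] at hdisp
      rw [← ENNReal.ofReal_tsum_of_nonneg (fun _ => abs_nonneg _) hs] at hdisp
      exact (ENNReal.ofReal_lt_ofReal_iff (by positivity)).1 hdisp
    have hle : ‖π.hom g ξ - ξ‖ ^ 2 ≤ ∑' y, |f (g⁻¹ • y) - f y| := by
      refine hasSum_le (fun z => ?_) (ellTwo_hasSum_norm_sq (π.hom g ξ - ξ))
        (e.symm.hasSum_iff.2 hs.hasSum)
      change ‖((√(f (e.symm ((ρ g)⁻¹ z))) : ℝ) : ℂ) - ((√(f (e.symm z)) : ℝ) : ℂ)‖ ^ 2 ≤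
        |f (g⁻¹ • e.symm z) - f (e.symm z)|
      rw [hρ', e.symm_apply_apply]
      exact norm_sqrt_sub_sqrt_sq_le _ _ (hf0 _) (hf0 _)
    exact (sq_le_sq₀ (norm_nonneg _) hε.le).1 (hle.trans hsum.le)
  obtain ⟨η, hη, hinv⟩ := hQ _ π ⟨ξ, halmost⟩
  refine hη (ellTwo_eq_zero_of_invariant ρ (fun z => ?_) hinv)
  have : (Set.range fun g => ρ g z) = e '' MulAction.orbit G (e.symm z) := by
    rw [MulAction.orbit, ← Set.range_comp]
    rfl
  rw [this]
  exact (hinf _).image e.injective.injOn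

end PermutationRepresentation

/-! ### The pointwise topology on `Aut X`, and the hypotheses verified for it. -/

section Automorphisms

open FirstOrder

variable {L : FirstOrder.Language.{u, v}} {X : Type w} [L.Structure X]

theorem isOpen_smul_eq (a b : X) : IsOpen {g : Aut L X | g • a = b} := by
  let _ : TopologicalSpace X := ⊥
  have : DiscreteTopology X := ⟨rfl⟩
  have h1 : Continuous fun g : Aut L X => (fun a => g a : X → X) := continuous_induced_dom
  exact (isOpen_discrete {b}).preimage ((continuous_apply a).comp h1)

theorem exists_fixingSubgroup_subset_of_mem_nhds {U : Set (Aut L X)} (hU : U ∈ nhds (1 : Aut L X)) :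
    ∃ A : Set X, A.Finite ∧ (fixingSubgroup (Aut L X) A : Set (Aut L X)) ⊆ U := by
  let _ : TopologicalSpace X := ⊥
  have : DiscreteTopology X := ⟨rfl⟩
  rw [nhds_induced, Filter.mem_comap] at hU
  obtain ⟨T, hT, hTU⟩ := hU
  rw [nhds_pi, Filter.mem_pi] at hT
  obtain ⟨A, hA, t, ht, htT⟩ := hT
  refine ⟨A, hA, fun g hg => hTU (htT fun a ha => ?_)⟩
  have h1 : g a = a := (mem_fixingSubgroup_iff _).1 hg a ha
  have h2 : a ∈ t a := mem_of_mem_nhds (ht a)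
  change g a ∈ t a
  rwa [h1]

theorem UnitaryRep.isFixerContinuous {H : Type*} [NormedAddCommGroup H] [InnerProductSpace ℂ H]
    (π : UnitaryRep (Aut L X) H) : IsFixerContinuous X π.hom := by
  intro ξ ε hε
  have h1 := (π.strongly_continuous ξ).continuousAt (x := 1) (Metric.ball_mem_nhds _ hε)
  obtain ⟨A, hA, hAU⟩ := exists_fixingSubgroup_subset_of_mem_nhds h1
  refine ⟨A, hA, fun g hg => ?_⟩
  have h2 : π.hom g ξ ∈ Metric.ball (π.hom 1 ξ) ε := hAU hg
  rwa [rep_one, mem_ball_iff_norm] at h2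

theorem isOligomorphic_aut [Countable L.Symbols] (hcat : IsOmegaCategorical L X) :
    IsOligomorphic (Aut L X) X := fun _ => exists_finite_orbit_representatives hcat

theorem hasFiniteIndexFixers_aut [Countable L.Symbols] (hcat : IsOmegaCategorical L X)
    (hwei : WeakEliminationOfImaginaries L X) : HasFiniteIndexFixers (Aut L X) X := by
  intro V A hA hAV
  obtain ⟨m, a, rfl⟩ := exists_tuple_of_finite hA
  obtain ⟨n, c, hc, hfin⟩ := exists_tuple_of_stabilizer_le hcat hwei V a fun g hg =>
    hAV (mem_fixingSubgroup_range_iff.2 hg)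
  refine ⟨Set.range c, Set.finite_range c, fun g hg => hc g (mem_fixingSubgroup_range_iff.1 hg), ?_⟩
  rintro _ ⟨i, rfl⟩
  refine (hfin.image fun d => d i).subset ?_
  rintro _ ⟨g, rfl⟩
  exact ⟨g.1 • c, ⟨g.1, g.2, rfl⟩, rfl⟩

end Automorphisms
end KazhdanOligomorphic

theorem propositionp (L : FirstOrder.Language.{u, v}) [Countable L.Symbols]
    (X : Type w) [L.Structure X]
    (hcat : IsOmegaCategorical L X)
    (hwei : WeakEliminationOfImaginaries L X)
    (Q : Set (Aut L X)) :
    (IsCompact Q → 0 < ellOneConstant (nonfixed L X) Q → IsKazhdanSet.{w, x} Q) ∧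
    ((∀ a : nonfixed L X, (MulAction.orbit (Aut L X) a).Infinite) →
      IsKazhdanSet.{w, x} Q → 0 < ellOneConstant (nonfixed L X) Q) := by
  constructor
  · intro hcomp hpos
    obtain ⟨r, hr0, hr⟩ := ENNReal.lt_iff_exists_nnreal_btwn.1 hpos
    have hr0' : (0 : ℝ) < r := by exact_mod_cast hr0
    -- With `ε = r / 3`, the bound `3 t` at `t = r / 3` is `r`, which lies strictly below the
    -- constant in (*).
    refine ⟨hcomp, r / 3, by positivity, fun H _ _ _ π ⟨ξ, hξ0, hξ⟩ => ?_⟩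
    by_contra! hcon
    have hnorm : 0 < ‖ξ‖ := norm_pos_iff.2 hξ0
    have hle := ellOneConstant_le_of_almost_invariant (Y := nonfixed L X) (π := π.hom)
      (isOligomorphic_aut hcat) (hasFiniteIndexFixers_aut hcat hwei) π.isFixerContinuous
      (fun a ha => not_not.1 ha)
      (fun η hη => by
        by_contra h0
        obtain ⟨g, hg⟩ := hcon η h0
        exact hg (hη g))
      (Q := Q) (ξ := ((‖ξ‖⁻¹ : ℝ) : ℂ) • ξ)
      (by
        rw [norm_smul, Complex.norm_real, norm_inv, norm_norm]
        exact inv_mul_cancel₀ hnorm.ne')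
      (t := r / 3) (by positivity)
      (fun g hg => by
        rw [map_smul, ← smul_sub, norm_smul, Complex.norm_real, norm_inv, norm_norm,
          inv_mul_le_iff₀ hnorm, mul_comm]
        exact hξ g hg)
    rw [mul_div_cancel₀ _ (by norm_num : (3 : ℝ) ≠ 0), ENNReal.ofReal_coe_nnreal] at hle
    exact absurd hr (not_lt.2 hle)
  · rintro hinf ⟨-, ε, hε, hQ⟩
    have := hcat.1
    refine ellOneConstant_pos_of_isKazhdanPair (fun a b => ?_) hinf hε hQ
    have : {g : Aut L X | g • a = b} = {g : Aut L X | g • (a : X) = b} := by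
      ext g
      exact Subtype.ext_iff
    rw [this]
    exact isOpen_smul_eq _ _
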